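/- Let $\mathbb{H}$ be the quaternions, $\mathbb{B}=\{q\in\mathbb{H}:|q|<1\}$, $\mathrm{Sp}(1)=\{u\in\mathbb{H}:|u|=1\}$ and $$\mathrm{Sp}(1,1)=\{A\in M_2(\mathbb{H}) : A^*I_{1,1}A=I_{1,1}\},\qquad I_{1,1}=\begin{pmatrix}1&0\\0&-1\end{pmatrix},$$ the latter two with their usual Lie group structures. For functions $f(q)=\sum_{n\ge 0} q^na_n$ and $g(q)=\sum_{n\ge 0} q^nb_n$ given by power series converging on $\mathbb{B}$ (that is, slice regular functions), put $$(f*g)(q)=\sum_{n\ge0} q^n\sum_{k=0}^n a_kb_{n-k},\qquad f^c(q)=\sum_{n\ge0} q^n\overline{a_n},\qquad f^s=f*f^c,\qquad f^{-*}=\frac{1}{f^s}f^c,$$ the last one off the zeros of $f^s$. For $A=\begin{pmatrix}a&c\\b&d\end{pmatrix}\in\mathrm{Sp}(1,1)$ let $\mathcal{F}_A$ be the regular Möbius transformation $$\mathcal{F}_A(q)=(qc+d)^{-*}*(qa+b),\qquad q\in\mathbb{B},$$ and let $\mathcal{M}(\mathbb{B})=\{\mathcal{F}_A : A\in\mathrm{Sp}(1,1)\}$.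 Then every $\mathcal{F}_A$ maps $\mathbb{B}$ into $\mathbb{B}$. There is one and only one structure of smooth $7$-dimensional manifold on $\mathcal{M}(\mathbb{B})$ for which $A\,\mathrm{Sp}(1)I_2\mapsto\mathcal{F}_{A^{-1}}$ is a (well-defined) diffeomorphism $\mathrm{Sp}(1,1)/\mathrm{Sp}(1)I_2\to\mathcal{M}(\mathbb{B})$, where $\mathrm{Sp}(1,1)/\mathrm{Sp}(1)I_2$ has the quotient topology and a smooth manifold structure making the quotient map a submersion. With this structure on $\mathcal{M}(\mathbb{B})$, the map $$\pi:\mathrm{Sp}(1,1)\to\mathcal{M}(\mathbb{B}),\qquad A\mapsto\mathcal{F}_{A^{-1}},$$ is a principal fiber bundle with structure group $\mathrm{Sp}(1)$ acting on $\mathrm{Sp}(1,1)$ by the right translations $(A,u)\mapsto A\,(uI_2)$. That is: $\pi$ is a surjective smooth map whose differential at every point is surjective; the action is smooth, free and proper, and its orbits are precisely the fibers of $\pi$; and every point of $\mathcal{M}(\mathbb{B})$ has an open neighborhood $U$ with a diffeomorphism $\varphi_U:U\times\mathrm{Sp}(1)\to\pi^{-1}(U)$ such that $\pi(\varphi_U(x,u))=x$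 and $\varphi_U(x,uv)=\varphi_U(x,u)\,(vI_2)$ for all $x\in U$ and $u,v\in\mathrm{Sp}(1)$. -/

import Mathlib

open scoped Manifold ContDiff Quaternion Matrix

noncomputable section

namespace QuatMoebius

/-! ### The groups `Sp(1)` and `Sp(1,1)` -/

/-- The unit ball of the quaternions. -/
abbrev UnitBall : Type := Metric.ball (0 : ℍ[ℝ]) 1

/-- `Sp(1)`, the group of unit quaternions, i.e. the unit sphere of `ℍ` with quaternionic
multiplication and with the usual manifold structure of the 3-sphere. -/
abbrev Sp1 : Type := Metric.sphere (0 : ℍ[ℝ]) 1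

instance finrankQuaternion : Fact (Module.finrank ℝ ℍ[ℝ] = 3 + 1) :=
  ⟨Quaternion.finrank_eq_four⟩

/-- The matrix `I_{1,1}`. -/
def signatureMatrix : Matrix (Fin 2) (Fin 2) ℍ[ℝ] := !![1, 0; 0, -1]

/-- `Sp(1,1)`, the quaternionic matrices with `A^* I_{1,1} A = I_{1,1}`. It carries the topology
induced from the space of matrices. -/
def Sp11 : Type :=
  {A : Matrix (Fin 2) (Fin 2) ℍ[ℝ] // Aᴴ * signatureMatrix * A = signatureMatrix}

instance : TopologicalSpace Sp11 :=
  inferInstanceAs (TopologicalSpace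
    {A : Matrix (Fin 2) (Fin 2) ℍ[ℝ] // Aᴴ * signatureMatrix * A = signatureMatrix})

theorem signatureMatrix_mul_self : signatureMatrix * signatureMatrix = 1 := by
  ext i j : 1
  fin_cases i <;> fin_cases j <;> simp [signatureMatrix, Matrix.mul_apply, Fin.sum_univ_two]

theorem signatureMatrix_conjTranspose : signatureMatrixᴴ = signatureMatrix := by
  ext i j : 1
  fin_cases i <;> fin_cases j <;> simp [signatureMatrix]

theorem Sp11.inv_mul_aux (A : Sp11) :
    (signatureMatrix * A.1ᴴ * signatureMatrix) * A.1 = 1 := by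
  rw [Matrix.mul_assoc, Matrix.mul_assoc, ← Matrix.mul_assoc (A.1ᴴ), A.2,
    signatureMatrix_mul_self]

theorem Sp11.mul_inv_aux (A : Sp11) :
    A.1 * (signatureMatrix * A.1ᴴ * signatureMatrix) = 1 :=
  mul_eq_one_comm.mp A.inv_mul_aux

theorem Sp11.mul_signature_conjTranspose (A : Sp11) :
    A.1 * signatureMatrix * A.1ᴴ = signatureMatrix := by
  have h := congrArg (· * signatureMatrix) A.mul_inv_aux
  simpa only [Matrix.mul_assoc, signatureMatrix_mul_self, Matrix.mul_one, Matrix.one_mul] using h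

instance : Group Sp11 where
  mul A B := ⟨A.1 * B.1, by
    rw [Matrix.conjTranspose_mul]
    calc B.1ᴴ * A.1ᴴ * signatureMatrix * (A.1 * B.1)
        = B.1ᴴ * (A.1ᴴ * signatureMatrix * A.1) * B.1 := by simp only [Matrix.mul_assoc]
      _ = signatureMatrix := by rw [A.2, B.2]⟩
  one := ⟨1, by simp⟩
  inv A := ⟨signatureMatrix * A.1ᴴ * signatureMatrix, by
    simp only [Matrix.conjTranspose_mul, Matrix.conjTranspose_conjTranspose,
      signatureMatrix_conjTranspose]
    calc signatureMatrix * (A.1 * signatureMatrix) * signatureMatrix *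
          (signatureMatrix * A.1ᴴ * signatureMatrix)
        = signatureMatrix * (A.1 * signatureMatrix * (signatureMatrix * signatureMatrix)
            * A.1ᴴ) * signatureMatrix := by simp only [Matrix.mul_assoc]
      _ = signatureMatrix := by
        rw [signatureMatrix_mul_self, Matrix.mul_one, A.mul_signature_conjTranspose,
          signatureMatrix_mul_self, Matrix.one_mul]⟩
  mul_assoc A B C := Subtype.ext (Matrix.mul_assoc _ _ _)
  one_mul A := Subtype.ext (Matrix.one_mul _)
  mul_one A := Subtype.ext (Matrix.mul_one _)
  inv_mul_cancel A := Subtype.ext A.inv_mul_aux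

theorem Sp11.coe_mul (A B : Sp11) : (A * B).1 = A.1 * B.1 := rfl

theorem Sp11.coe_one : (1 : Sp11).1 = 1 := rfl

theorem Sp11.coe_inv (A : Sp11) : (A⁻¹).1 = signatureMatrix * A.1ᴴ * signatureMatrix := rfl

/-- The entries of `A` satisfy `|a|² - |b|² = 1`, `|d|² - |c|² = 1`, `a̅ c = b̅ d`, where
`A = (a c; b d)`. -/
theorem mem_Sp11_iff (A : Matrix (Fin 2) (Fin 2) ℍ[ℝ]) :
    Aᴴ * signatureMatrix * A = signatureMatrix ↔
      ‖A 0 0‖ ^ 2 = 1 + ‖A 1 0‖ ^ 2 ∧ ‖A 1 1‖ ^ 2 = 1 + ‖A 0 1‖ ^ 2 ∧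
        star (A 0 0) * A 0 1 = star (A 1 0) * A 1 1 := by
  have key : ∀ x y : ℍ[ℝ], (star x * x - star y * y = ((‖x‖ ^ 2 - ‖y‖ ^ 2 : ℝ) : ℍ[ℝ])) := by
    intro x y
    rw [Quaternion.star_mul_self, Quaternion.star_mul_self, Quaternion.normSq_eq_norm_mul_self,
      Quaternion.normSq_eq_norm_mul_self, pow_two, pow_two]
    push_cast
    rfl
  constructor
  · intro h
    have h00 := congrFun (congrFun h 0) 0
    have h11 := congrFun (congrFun h 1) 1
    have h01 := congrFun (congrFun h 0) 1
    simp [signatureMatrix, Matrix.mul_apply, Fin.sum_univ_two, ← sub_eq_add_neg] at h00 h11 h01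
    rw [key _ _] at h00
    have h11' : star (A 0 1) * A 0 1 - star (A 1 1) * A 1 1 = -1 := by simpa using h11
    rw [key _ _] at h11'
    have e0 : ‖A 0 0‖ ^ 2 - ‖A 1 0‖ ^ 2 = 1 :=
      Quaternion.coe_injective (by simpa using h00)
    have e1 : ‖A 0 1‖ ^ 2 - ‖A 1 1‖ ^ 2 = -1 :=
      Quaternion.coe_injective (by simpa using h11')
    refine ⟨by linarith, by linarith, sub_eq_zero.mp h01⟩
  · rintro ⟨h0, h1, h2⟩
    have h2' : star (A 0 1) * A 0 0 = star (A 1 1) * A 1 0 := by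
      have := congrArg star h2
      simpa [star_mul] using this
    have e0 := key (A 0 0) (A 1 0)
    have e1 := key (A 0 1) (A 1 1)
    rw [show ‖A 0 0‖ ^ 2 - ‖A 1 0‖ ^ 2 = 1 by linarith] at e0
    rw [show ‖A 0 1‖ ^ 2 - ‖A 1 1‖ ^ 2 = -1 by linarith] at e1
    ext i j : 1
    fin_cases i <;> fin_cases j <;>
      simp [signatureMatrix, Matrix.mul_apply, Fin.sum_univ_two, ← sub_eq_add_neg]
    · simpa using e0
    · exact sub_eq_zero.mpr h2
    · exact sub_eq_zero.mpr h2'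
    · simpa using e1

/-! ### The manifold structure of `Sp(1,1)`

`Sp(1,1)` is a closed submanifold of the space of matrices. The matrix with entries
`a = s u`, `c = u b̅ v`, `d = s v`, where `s = √(1 + |b|²)`, runs through `Sp(1,1)` exactly once
as `(b, u, v)` runs through `ℍ × Sp(1) × Sp(1)`; the charts are those of this product. The results
below show that this is the structure of an embedded submanifold of the space of matrices, and that
`Sp(1,1)` is a Lie group with it. -/

/-- The parameters `(b, u, v)`. -/
abbrev Sp11Param : Type := ℍ[ℝ] × Sp1 × Sp1

/-- The space on which the charts of `Sp(1,1)` take their values. -/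
abbrev Sp11Model : Type :=
  ModelProd ℍ[ℝ] (ModelProd (EuclideanSpace ℝ (Fin 3)) (EuclideanSpace ℝ (Fin 3)))

/-- The (boundaryless) model of `Sp(1,1)`. -/
abbrev sp11ModelWithCorners :
    ModelWithCorners ℝ (ℍ[ℝ] × EuclideanSpace ℝ (Fin 3) × EuclideanSpace ℝ (Fin 3)) Sp11Model :=
  𝓘(ℝ, ℍ[ℝ]).prod ((𝓡 3).prod (𝓡 3))

theorem norm_Sp1 (u : Sp1) : ‖(u : ℍ[ℝ])‖ = 1 := by simp

/-- The matrix with parameters `(b, u, v)`. -/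
def sp11OfParam (x : Sp11Param) : Sp11 :=
  ⟨!![√(1 + ‖x.1‖ ^ 2) • (x.2.1 : ℍ[ℝ]), x.2.1 * star x.1 * x.2.2;
      x.1, √(1 + ‖x.1‖ ^ 2) • (x.2.2 : ℍ[ℝ])], by
    have hs : √(1 + ‖x.1‖ ^ 2) ^ 2 = 1 + ‖x.1‖ ^ 2 := Real.sq_sqrt (by positivity)
    rw [mem_Sp11_iff]
    refine ⟨?_, ?_, ?_⟩
    · simp [norm_smul, hs]
    · simp [norm_smul, hs]
    · have h : star (x.2.1 : ℍ[ℝ]) * x.2.1 = 1 := by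
        rw [Quaternion.star_mul_self, Quaternion.normSq_eq_norm_mul_self, norm_Sp1]; simp
      simp only [Matrix.of_apply, Matrix.cons_val', Matrix.cons_val_zero, Matrix.cons_val_one,
        Matrix.cons_val_fin_one, Quaternion.star_smul, smul_mul_assoc, mul_smul_comm]
      rw [← mul_assoc, ← mul_assoc, h, one_mul]⟩

theorem Sp11.entries (A : Sp11) :
    ‖A.1 0 0‖ ^ 2 = 1 + ‖A.1 1 0‖ ^ 2 ∧ ‖A.1 1 1‖ ^ 2 = 1 + ‖A.1 0 1‖ ^ 2 ∧
      star (A.1 0 0) * A.1 0 1 = star (A.1 1 0) * A.1 1 1 := (mem_Sp11_iff A.1).mp A.2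

theorem Sp11.a_ne_zero (A : Sp11) : A.1 0 0 ≠ 0 := fun h => by
  have := A.entries.1
  rw [h, norm_zero] at this
  nlinarith [sq_nonneg ‖A.1 1 0‖]

theorem Sp11.d_ne_zero (A : Sp11) : A.1 1 1 ≠ 0 := fun h => by
  have := A.entries.2.1
  rw [h, norm_zero] at this
  nlinarith [sq_nonneg ‖A.1 0 1‖]

theorem Sp11.norm_a (A : Sp11) : ‖A.1 0 0‖ = √(1 + ‖A.1 1 0‖ ^ 2) := by
  rw [← A.entries.1, Real.sqrt_sq (norm_nonneg _)]

theorem Sp11.norm_d (A : Sp11) : ‖A.1 1 1‖ = √(1 + ‖A.1 1 0‖ ^ 2) := by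
  obtain ⟨h0, h1, h2⟩ := A.entries
  have h3 : ‖A.1 0 0‖ ^ 2 * ‖A.1 0 1‖ ^ 2 = ‖A.1 1 0‖ ^ 2 * ‖A.1 1 1‖ ^ 2 := by
    have := congrArg norm h2
    rw [norm_mul, norm_mul, norm_star, norm_star] at this
    rw [← mul_pow, ← mul_pow, this]
  have h4 : ‖A.1 1 1‖ ^ 2 = 1 + ‖A.1 1 0‖ ^ 2 := by nlinarith
  rw [← h4, Real.sqrt_sq (norm_nonneg _)]

/-- The parameters `(b, a / |a|, d / |d|)` of a matrix in `Sp(1,1)`. -/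
def sp11ToParam (A : Sp11) : Sp11Param :=
  (A.1 1 0,
    ⟨‖A.1 0 0‖⁻¹ • A.1 0 0, by
      rw [mem_sphere_zero_iff_norm, norm_smul, norm_inv, norm_norm]
      exact inv_mul_cancel₀ (norm_ne_zero_iff.mpr A.a_ne_zero)⟩,
    ⟨‖A.1 1 1‖⁻¹ • A.1 1 1, by
      rw [mem_sphere_zero_iff_norm, norm_smul, norm_inv, norm_norm]
      exact inv_mul_cancel₀ (norm_ne_zero_iff.mpr A.d_ne_zero)⟩)

theorem sp11OfParam_toParam (A : Sp11) : sp11OfParam (sp11ToParam A) = A := by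
  have ha : ‖A.1 0 0‖ ≠ 0 := norm_ne_zero_iff.mpr A.a_ne_zero
  have hd : ‖A.1 1 1‖ ≠ 0 := norm_ne_zero_iff.mpr A.d_ne_zero
  have had : ‖A.1 1 1‖ = ‖A.1 0 0‖ := by rw [A.norm_a, A.norm_d]
  have hc : A.1 0 0 * star (A.1 1 0) * A.1 1 1 = (‖A.1 0 0‖ ^ 2) • A.1 0 1 := by
    rw [mul_assoc, ← A.entries.2.2, ← mul_assoc, Quaternion.self_mul_star,
      Quaternion.normSq_eq_norm_mul_self, ← pow_two, Quaternion.coe_mul_eq_smul]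
  apply Subtype.ext
  ext i j : 1
  fin_cases i <;> fin_cases j
  · simp [sp11OfParam, sp11ToParam, ← A.norm_a, smul_smul, ha]
  · simp only [sp11OfParam, sp11ToParam, Fin.zero_eta, Fin.mk_one, Matrix.of_apply,
      Matrix.cons_val', Matrix.cons_val_zero, Matrix.cons_val_one, Matrix.cons_val_fin_one,
      smul_mul_assoc, mul_smul_comm, hc, smul_smul, had]
    field_simp
    simp
  · simp [sp11OfParam, sp11ToParam]
  · simp [sp11OfParam, sp11ToParam, ← A.norm_d, smul_smul, hd]

theorem sp11ToParam_ofParam (x : Sp11Param) : sp11ToParam (sp11OfParam x) = x := by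
  have hs : 0 < √(1 + ‖x.1‖ ^ 2) := Real.sqrt_pos.mpr (by positivity)
  refine Prod.ext ?_ (Prod.ext (Subtype.ext ?_) (Subtype.ext ?_))
  · simp [sp11OfParam, sp11ToParam]
  · simp [sp11OfParam, sp11ToParam, norm_smul, smul_smul, abs_of_pos hs, hs.ne']
  · simp [sp11OfParam, sp11ToParam, norm_smul, smul_smul, abs_of_pos hs, hs.ne']

theorem Sp11.continuous_entry (i j : Fin 2) : Continuous fun A : Sp11 => A.1 i j :=
  (continuous_subtype_val (p := fun A : Matrix (Fin 2) (Fin 2) ℍ[ℝ] =>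
    Aᴴ * signatureMatrix * A = signatureMatrix)).matrix_elem i j

/-- `Sp(1,1)` is homeomorphic to `ℍ × Sp(1) × Sp(1)`. -/
def sp11Homeomorph : Sp11 ≃ₜ Sp11Param where
  toFun := sp11ToParam
  invFun := sp11OfParam
  left_inv := sp11OfParam_toParam
  right_inv := sp11ToParam_ofParam
  continuous_toFun := by
    refine (Sp11.continuous_entry 1 0).prodMk (.prodMk (.subtype_mk ?_ _) (.subtype_mk ?_ _))
    · exact ((Sp11.continuous_entry 0 0).norm.inv₀ fun A => norm_ne_zero_iff.mpr A.a_ne_zero).smul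
        (Sp11.continuous_entry 0 0)
    · exact ((Sp11.continuous_entry 1 1).norm.inv₀ fun A => norm_ne_zero_iff.mpr A.d_ne_zero).smul
        (Sp11.continuous_entry 1 1)
  continuous_invFun := by
    refine Continuous.subtype_mk (continuous_matrix fun i j => ?_) _
    fin_cases i <;> fin_cases j <;> simp <;> fun_prop

instance : ChartedSpace Sp11Model Sp11 where
  atlas := {e | ∃ f ∈ atlas Sp11Model Sp11Param, e = sp11Homeomorph.toOpenPartialHomeomorph ≫ₕ f}
  chartAt A := sp11Homeomorph.toOpenPartialHomeomorph ≫ₕ chartAt Sp11Model (sp11Homeomorph A)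
  mem_chart_source A := by simp
  chart_mem_atlas A := ⟨_, chart_mem_atlas _ _, rfl⟩

instance : IsManifold sp11ModelWithCorners ∞ Sp11 where
  compatible := by
    rintro _ _ ⟨f, hf, rfl⟩ ⟨g, hg, rfl⟩
    have h := HasGroupoid.compatible (G := contDiffGroupoid ∞ sp11ModelWithCorners) hf hg
    have e : (sp11Homeomorph.toOpenPartialHomeomorph ≫ₕ f).symm ≫ₕ
        (sp11Homeomorph.toOpenPartialHomeomorph ≫ₕ g) = f.symm ≫ₕ g := by
      rw [OpenPartialHomeomorph.trans_symm_eq_symm_trans_symm, OpenPartialHomeomorph.trans_assoc,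
        ← OpenPartialHomeomorph.trans_assoc _ _ g, ← Homeomorph.symm_toOpenPartialHomeomorph,
        ← Homeomorph.trans_toOpenPartialHomeomorph, Homeomorph.symm_trans_self,
        Homeomorph.refl_toOpenPartialHomeomorph, OpenPartialHomeomorph.refl_trans]
    rwa [e]

theorem contDiff_star_quaternion : ContDiff ℝ ∞ (star : ℍ[ℝ] → ℍ[ℝ]) :=
  (LinearMap.toContinuousLinearMap
    { toFun := (star : ℍ[ℝ] → ℍ[ℝ])
      map_add' := star_add
      map_smul' := fun r q => Quaternion.star_smul r q }).contDiff

theorem extChartAt_sp11 (A : Sp11) : extChartAt sp11ModelWithCorners A =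
    sp11Homeomorph.toEquiv.toPartialEquiv.trans
      (extChartAt sp11ModelWithCorners (sp11Homeomorph A)) :=
  PartialEquiv.trans_assoc _ _ _

theorem contMDiff_sp11Homeomorph :
    ContMDiff sp11ModelWithCorners sp11ModelWithCorners ∞ sp11Homeomorph := by
  rw [contMDiff_iff]
  refine ⟨sp11Homeomorph.continuous, fun A x => ?_⟩
  have h := (contMDiff_iff.mp (contMDiff_id (I := sp11ModelWithCorners) (n := ∞)
    (M := Sp11Param))).2 (sp11Homeomorph A) x
  rw [extChartAt_sp11]
  refine (h.mono ?_).congr ?_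
  · rintro y ⟨hy, hy'⟩
    refine ⟨hy.1, ?_⟩
    simpa using hy'
  · intro y _
    simp

theorem contMDiff_sp11Homeomorph_symm :
    ContMDiff sp11ModelWithCorners sp11ModelWithCorners ∞ sp11Homeomorph.symm := by
  rw [contMDiff_iff]
  refine ⟨sp11Homeomorph.symm.continuous, fun x A => ?_⟩
  have h := (contMDiff_iff.mp (contMDiff_id (I := sp11ModelWithCorners) (n := ∞)
    (M := Sp11Param))).2 x (sp11Homeomorph A)
  rw [extChartAt_sp11]
  refine (h.mono ?_).congr ?_
  · rintro y ⟨hy, hy'⟩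
    refine ⟨hy, ?_⟩
    simpa using hy'
  · intro y _
    simp

section Smooth

variable {E : Type*} [NormedAddCommGroup E] [NormedSpace ℝ E] {H : Type*} [TopologicalSpace H]
  {I : ModelWithCorners ℝ E H} {N : Type*} [TopologicalSpace N] [ChartedSpace H N]
  [IsManifold I ∞ N]

/-- The entries are smooth functions on `Sp(1,1)`. -/
theorem Sp11.contMDiff_entry (i j : Fin 2) :
    ContMDiff sp11ModelWithCorners 𝓘(ℝ, ℍ[ℝ]) ∞ fun A : Sp11 => A.1 i j := by
  suffices h : ContMDiff sp11ModelWithCorners 𝓘(ℝ, ℍ[ℝ]) ∞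
      fun x : Sp11Param => (sp11OfParam x).1 i j by
    convert h.comp contMDiff_sp11Homeomorph using 2 with A
    exact congrArg (fun B : Sp11 => B.1 i j) (sp11OfParam_toParam A).symm
  have hb : ContMDiff sp11ModelWithCorners 𝓘(ℝ, ℍ[ℝ]) ∞ fun x : Sp11Param => x.1 := contMDiff_fst
  have hu : ContMDiff sp11ModelWithCorners 𝓘(ℝ, ℍ[ℝ]) ∞
      fun x : Sp11Param => (x.2.1 : ℍ[ℝ]) :=
    contMDiff_coe_sphere.comp (contMDiff_fst.comp contMDiff_snd)
  have hv : ContMDiff sp11ModelWithCorners 𝓘(ℝ, ℍ[ℝ]) ∞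
      fun x : Sp11Param => (x.2.2 : ℍ[ℝ]) :=
    contMDiff_coe_sphere.comp (contMDiff_snd.comp contMDiff_snd)
  have hs : ContMDiff sp11ModelWithCorners 𝓘(ℝ, ℝ) ∞
      fun x : Sp11Param => √(1 + ‖x.1‖ ^ 2) := by
    have : ContDiff ℝ ∞ fun b : ℍ[ℝ] => √(1 + ‖b‖ ^ 2) :=
      (contDiff_const.add (contDiff_norm_sq ℝ)).sqrt fun b => by positivity
    exact this.contMDiff.comp hb
  have hbs : ContMDiff sp11ModelWithCorners 𝓘(ℝ, ℍ[ℝ]) ∞ fun x : Sp11Param => star x.1 :=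
    contDiff_star_quaternion.contMDiff.comp hb
  have hmul : ContDiff ℝ ∞ fun p : ℍ[ℝ] × ℍ[ℝ] => p.1 * p.2 := contDiff_mul
  fin_cases i <;> fin_cases j
  · exact hs.smul hu
  · exact hmul.contMDiff.comp ((hmul.contMDiff.comp (hu.prodMk_space hbs)).prodMk_space hv)
  · exact hb
  · exact hs.smul hv

/-- A map into `Sp(1,1)` is smooth if and only if it is smooth as a map into the space of
matrices. -/
theorem Sp11.contMDiff_iff {f : N → Sp11} :
    ContMDiff I sp11ModelWithCorners ∞ f ↔
      ∀ i j, ContMDiff I 𝓘(ℝ, ℍ[ℝ]) ∞ fun x => (f x).1 i j := by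
  refine ⟨fun h i j => (Sp11.contMDiff_entry i j).comp h, fun h => ?_⟩
  have hn : ContDiffOn ℝ ∞ (fun q : ℍ[ℝ] => ‖q‖⁻¹ • q) {0}ᶜ := fun q hq =>
    ((((contDiffAt_norm ℝ hq).inv (norm_ne_zero_iff.mpr hq)).smul
      contDiffAt_id)).contDiffWithinAt
  suffices hp : ContMDiff I sp11ModelWithCorners ∞ fun x => sp11Homeomorph (f x) by
    convert contMDiff_sp11Homeomorph_symm.comp hp using 1
    funext x
    exact (sp11Homeomorph.symm_apply_apply (f x)).symm
  refine (h 1 0).prodMk (.prodMk (.codRestrict_sphere ?_ _) (.codRestrict_sphere ?_ _))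
  · exact hn.contMDiffOn.comp_contMDiff (h 0 0) fun x => (f x).a_ne_zero
  · exact hn.contMDiffOn.comp_contMDiff (h 1 1) fun x => (f x).d_ne_zero

end Smooth

instance : LieGroup sp11ModelWithCorners ∞ Sp11 where
  contMDiff_mul := by
    rw [Sp11.contMDiff_iff]
    intro i j
    have hmul : ContDiff ℝ ∞ fun p : ℍ[ℝ] × ℍ[ℝ] => p.1 * p.2 := contDiff_mul
    have h : ∀ k, ContMDiff (sp11ModelWithCorners.prod sp11ModelWithCorners) 𝓘(ℝ, ℍ[ℝ]) ∞
        fun x : Sp11 × Sp11 => x.1.1 i k * x.2.1 k j := fun k =>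
      hmul.contMDiff.comp (((Sp11.contMDiff_entry i k).comp contMDiff_fst).prodMk_space
        ((Sp11.contMDiff_entry k j).comp contMDiff_snd))
    simp only [Sp11.coe_mul, Matrix.mul_apply, Fin.sum_univ_two]
    exact (h 0).add (h 1)
  contMDiff_inv := by
    rw [Sp11.contMDiff_iff]
    have h : ∀ i j, ContMDiff sp11ModelWithCorners 𝓘(ℝ, ℍ[ℝ]) ∞
        fun A : Sp11 => star (A.1 i j) := fun i j =>
      contDiff_star_quaternion.contMDiff.comp (Sp11.contMDiff_entry i j)
    intro i j
    fin_cases i <;> fin_cases j <;>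
      simp [Sp11.coe_inv, signatureMatrix, Matrix.mul_apply, Matrix.vecMul, dotProduct,
        Fin.sum_univ_two]
    · exact h 0 0
    · exact (h 1 0).neg
    · exact (h 0 1).neg
    · exact h 1 1

/-- `Sp(1,1)` carries the topology induced from the space of matrices. -/
theorem Sp11.isEmbedding_entries :
    Topology.IsEmbedding (fun (A : Sp11) (i j : Fin 2) => A.1 i j) :=
  Topology.IsEmbedding.subtypeVal (p := fun A : Matrix (Fin 2) (Fin 2) ℍ[ℝ] =>
    Aᴴ * signatureMatrix * A = signatureMatrix)

/-- The inclusion of `Sp(1,1)` into the space of matrices is an immersion. -/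
theorem Sp11.injective_mfderiv_entries (A : Sp11) :
    Function.Injective (mfderiv sp11ModelWithCorners 𝓘(ℝ, Fin 2 → Fin 2 → ℍ[ℝ])
      (fun (A : Sp11) (i j : Fin 2) => A.1 i j) A) := by
  let ι : Sp11 → Fin 2 → Fin 2 → ℍ[ℝ] := fun A i j => A.1 i j
  let j : Sp11Param → ℍ[ℝ] × ℍ[ℝ] × ℍ[ℝ] := Prod.map id (Prod.map (↑) (↑))
  let g : (Fin 2 → Fin 2 → ℍ[ℝ]) → ℍ[ℝ] × ℍ[ℝ] × ℍ[ℝ] := fun m =>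
    (m 1 0, ‖m 0 0‖⁻¹ • m 0 0, ‖m 1 1‖⁻¹ • m 1 1)
  have hι : ContMDiff sp11ModelWithCorners 𝓘(ℝ, Fin 2 → Fin 2 → ℍ[ℝ]) ∞ ι :=
    contMDiff_pi_space.mpr fun i => contMDiff_pi_space.mpr fun j => Sp11.contMDiff_entry i j
  let J : ModelWithCorners ℝ (ℍ[ℝ] × ℍ[ℝ] × ℍ[ℝ]) (ModelProd ℍ[ℝ] (ModelProd ℍ[ℝ] ℍ[ℝ])) :=
    𝓘(ℝ, ℍ[ℝ]).prod (𝓘(ℝ, ℍ[ℝ]).prod 𝓘(ℝ, ℍ[ℝ]))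
  have hg : MDifferentiableAt 𝓘(ℝ, Fin 2 → Fin 2 → ℍ[ℝ]) J g (ι A) := by
    have e : ∀ i k, DifferentiableAt ℝ (fun m : Fin 2 → Fin 2 → ℍ[ℝ] => m i k) (ι A) := by
      intro i k
      fun_prop
    refine (e 1 0).mdifferentiableAt.prodMk (.prodMk (DifferentiableAt.mdifferentiableAt ?_)
      (DifferentiableAt.mdifferentiableAt ?_))
    · exact (((e 0 0).norm ℝ A.a_ne_zero).inv (norm_ne_zero_iff.mpr A.a_ne_zero)).smul (e 0 0)
    · exact (((e 1 1).norm ℝ A.d_ne_zero).inv (norm_ne_zero_iff.mpr A.d_ne_zero)).smul (e 1 1)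
  have hS : ∀ u : Sp1, MDifferentiableAt (𝓡 3) 𝓘(ℝ, ℍ[ℝ]) ((↑) : Sp1 → ℍ[ℝ]) u := fun u =>
    (contMDiff_coe_sphere (m := ∞)).mdifferentiable (by simp) u
  have hj : MDifferentiableAt sp11ModelWithCorners J j (sp11Homeomorph A) :=
    mdifferentiableAt_id.prodMap ((hS _).prodMap (hS _))
  have hj' : Function.Injective (mfderiv sp11ModelWithCorners J j (sp11Homeomorph A)) := by
    have h1 : mfderiv sp11ModelWithCorners J j (sp11Homeomorph A) = _ :=
      mfderiv_prodMap mdifferentiableAt_id ((hS _).prodMap (hS _))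
    rw [h1, mfderiv_prodMap (hS _) (hS _), mfderiv_id]
    exact Function.injective_id.prodMap
      ((injective_mvfderiv_subtypeVal_sphere (E := ℍ[ℝ]) (n := 3) _).prodMap
        (injective_mvfderiv_subtypeVal_sphere (E := ℍ[ℝ]) (n := 3) _))
  have hΦ : MDifferentiableAt sp11ModelWithCorners sp11ModelWithCorners sp11Homeomorph A :=
    contMDiff_sp11Homeomorph.mdifferentiable (by simp) A
  have hΨ : MDifferentiableAt sp11ModelWithCorners sp11ModelWithCorners sp11Homeomorph.symm
      (sp11Homeomorph A) :=
    contMDiff_sp11Homeomorph_symm.mdifferentiable (by simp) _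
  have hΦ' : Function.Injective
      (mfderiv sp11ModelWithCorners sp11ModelWithCorners sp11Homeomorph A) := by
    have h := mfderiv_comp A hΨ hΦ
    rw [show sp11Homeomorph.symm ∘ sp11Homeomorph = id from
      funext sp11Homeomorph.symm_apply_apply, mfderiv_id] at h
    intro v w hvw
    have hv := congrArg (fun L => L v) h
    have hw := congrArg (fun L => L w) h
    exact hv.trans ((congrArg _ hvw).trans hw.symm)
  have h1 := mfderiv_comp A hj hΦ
  have h2 := mfderiv_comp A hg (hι.mdifferentiable (by simp) A)
  have h3 : j ∘ sp11Homeomorph = g ∘ ι := rfl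
  rw [h3, h2] at h1
  intro v w hvw
  have hv := congrArg (fun L => L v) h1
  have hw := congrArg (fun L => L w) h1
  exact hΦ' (hj' (hv.symm.trans ((congrArg _ hvw).trans hw)))

/-! ### The subgroup `Sp(1) I₂` and its right translations -/

/-- The homomorphism `u ↦ u I₂` from `Sp(1)` to `Sp(1,1)`. -/
def scalarHom : Sp1 →* Sp11 where
  toFun u := ⟨Matrix.diagonal fun _ => (u : ℍ[ℝ]), by
    rw [mem_Sp11_iff]
    simp⟩
  map_one' := Subtype.ext (by simp [Sp11.coe_one])
  map_mul' u v := Subtype.ext <|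
    (Matrix.diagonal_mul_diagonal (fun _ => (u : ℍ[ℝ])) (fun _ => (v : ℍ[ℝ]))).symm

/-- The subgroup `Sp(1) I₂` of `Sp(1,1)`. -/
def scalarSubgroup : Subgroup Sp11 := scalarHom.range

/-- The action of `Sp(1)` on `Sp(1,1)` by right translations, `(A, u) ↦ A (u I₂)`. -/
def rightTranslation (A : Sp11) (u : Sp1) : Sp11 := A * scalarHom u

/-! ### Slice regular functions on the ball and regular Möbius transformations -/

/-- `f(q) = ∑ qⁿ aₙ` on the unit ball, which is the power series expansion that every slice regular
function on the ball has. The coefficients are determined by `f`. -/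
def HasExpansion (f : UnitBall → ℍ[ℝ]) (a : ℕ → ℍ[ℝ]) : Prop :=
  ∀ q : UnitBall, HasSum (fun n => (q : ℍ[ℝ]) ^ n * a n) (f q)

open Classical in
/-- The coefficients of the power series expansion of `f` (zero if there is none). -/
def coeff (f : UnitBall → ℍ[ℝ]) : ℕ → ℍ[ℝ] :=
  if h : ∃ a, HasExpansion f a then h.choose else 0

/-- The function `q ↦ ∑ qⁿ aₙ` on the unit ball. -/
def ofCoeff (a : ℕ → ℍ[ℝ]) : UnitBall → ℍ[ℝ] := fun q => ∑' n, (q : ℍ[ℝ]) ^ n * a n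

/-- The regular product `f * g`, with coefficients `∑ₖ aₖ bₙ₋ₖ`. -/
def starMul (f g : UnitBall → ℍ[ℝ]) : UnitBall → ℍ[ℝ] :=
  ofCoeff fun n => ∑ k ∈ Finset.range (n + 1), coeff f k * coeff g (n - k)

/-- The regular conjugate `fᶜ`, with conjugated coefficients. -/
def regularConj (f : UnitBall → ℍ[ℝ]) : UnitBall → ℍ[ℝ] := ofCoeff fun n => star (coeff f n)

/-- The symmetrization `fˢ = f * fᶜ`. -/
def symmetrization (f : UnitBall → ℍ[ℝ]) : UnitBall → ℍ[ℝ] := starMul f (regularConj f)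

/-- The regular reciprocal `(1 / fˢ) fᶜ`, meaningful off the zeros of `fˢ`. -/
def starInv (f : UnitBall → ℍ[ℝ]) : UnitBall → ℍ[ℝ] :=
  fun q => (symmetrization f q)⁻¹ * regularConj f q

/-- The slice regular function `q ↦ q a + b`. -/
def linearFun (a b : ℍ[ℝ]) : UnitBall → ℍ[ℝ] := fun q => (q : ℍ[ℝ]) * a + b

/-- The regular Möbius transformation `𝓕_A(q) = (q c + d)^{-*} * (q a + b)` of
`A = (a c; b d) ∈ Sp(1,1)`. -/
def regularMoebius (A : Sp11) : UnitBall → ℍ[ℝ] :=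
  starMul (starInv (linearFun (A.1 0 1) (A.1 1 1))) (linearFun (A.1 0 0) (A.1 1 0))

/-- The set `𝓜(𝔹)` of the regular Möbius transformations `𝓕_A`, `A ∈ Sp(1,1)`. As a type of its
own it carries no topology. -/
def MoebiusB : Type := {f : UnitBall → ℍ[ℝ] // ∃ A : Sp11, regularMoebius A = f}

/-- The map `Sp(1,1) → 𝓜(𝔹)`, `A ↦ 𝓕_{A⁻¹}`. -/
def moebiusProj (A : Sp11) : MoebiusB := ⟨regularMoebius A⁻¹, A⁻¹, rfl⟩

/-! ### Manifolds, submersions and principal fiber bundles -/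

section Bundles

variable {EP : Type*} [NormedAddCommGroup EP] [NormedSpace ℝ EP] {HP : Type*} [TopologicalSpace HP]
  (IP : ModelWithCorners ℝ EP HP)
  {EM : Type*} [NormedAddCommGroup EM] [NormedSpace ℝ EM] {HM : Type*} [TopologicalSpace HM]
  (IM : ModelWithCorners ℝ EM HM)
  {EG : Type*} [NormedAddCommGroup EG] [NormedSpace ℝ EG] {HG : Type*} [TopologicalSpace HG]
  (IG : ModelWithCorners ℝ EG HG)
  {P : Type*} [TopologicalSpace P] [ChartedSpace HP P]
  {M : Type*} [TopologicalSpace M] [ChartedSpace HM M]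
  {G : Type*} [TopologicalSpace G] [ChartedSpace HG G] [Group G]

/-- `M` is a smooth finite-dimensional manifold without boundary, Hausdorff and second
countable. -/
structure IsSmoothManifold (M : Type*) [TopologicalSpace M] [ChartedSpace HM M] : Prop where
  finiteDimensional : FiniteDimensional ℝ EM
  boundaryless : IM.Boundaryless
  isManifold : IsManifold IM ∞ M
  t2 : T2Space M
  secondCountable : SecondCountableTopology M

/-- A submersion: a surjective smooth map whose differential at every point is surjective. -/
structure IsSurjSubmersion (f : P → M) : Prop where
  surjective : Function.Surjective f
  smooth : ContMDiff IP IM ∞ f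
  surjective_mfderiv : ∀ p, Function.Surjective (mfderiv IP IM f p)

/-- `π : P → M` is a principal fiber bundle with structure Lie group `G`, for the right action
`(p, g) ↦ act p g` of `G` on `P`. -/
structure IsPrincipalFiberBundle (act : P → G → P) (π : P → M) : Prop where
  total : IsSmoothManifold IP P
  base : IsSmoothManifold IM M
  group : IsSmoothManifold IG G
  lieGroup : LieGroup IG ∞ G
  submersion : IsSurjSubmersion IP IM π
  act_one : ∀ p, act p 1 = p
  act_mul : ∀ p g h, act p (g * h) = act (act p g) h
  smooth_act : ContMDiff (IP.prod IG) IP ∞ fun x : P × G => act x.1 x.2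
  free : ∀ p g, act p g = p → g = 1
  proper : ∀ K : Set P, IsCompact K → IsCompact {g : G | ((act · g) '' K ∩ K).Nonempty}
  orbit_eq_fiber : ∀ p, Set.range (act p) = π ⁻¹' {π p}
  /-- Local triviality: an equivariant diffeomorphism from `U × G` onto `π⁻¹(U)` over `U`. -/
  locallyTrivial : ∀ m : M, ∃ U : Set M, IsOpen U ∧ m ∈ U ∧
    ∃ φ : PartialDiffeomorph (IM.prod IG) IP (M × G) P ∞,
      φ.source = U ×ˢ Set.univ ∧ φ.target = π ⁻¹' U ∧
      ∀ x ∈ U, ∀ g : G, π (φ (x, g)) = x ∧ ∀ h : G, φ (x, g * h) = act (φ (x, g)) h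

end Bundles

/-! ### The manifold structure of `𝓜(𝔹)` -/

/-- A structure of smooth `n`-dimensional manifold on a set. -/
structure SmoothStructure (n : ℕ) (X : Type*) where
  top : TopologicalSpace X
  charts : ChartedSpace (EuclideanSpace ℝ (Fin n)) X
  isSmoothManifold : IsSmoothManifold (𝓡 n) X

/-- Two manifold structures on a set are the same if the identity is a diffeomorphism between
them. -/
def SmoothStructure.Same {n : ℕ} {X : Type*} (S T : SmoothStructure n X) : Prop :=
  @ContMDiff ℝ _ _ _ _ _ _ (𝓡 n) X S.top S.charts _ _ _ _ _ (𝓡 n) X T.top T.charts ∞ id ∧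
    @ContMDiff ℝ _ _ _ _ _ _ (𝓡 n) X T.top T.charts _ _ _ _ _ (𝓡 n) X S.top S.charts ∞ id

/-- The manifold structure `S` of `𝓜(𝔹)` is the quotient one: the assignment
`A Sp(1)I₂ ↦ 𝓕_{A⁻¹}` is a diffeomorphism onto `𝓜(𝔹)` from the quotient `Sp(1,1) / Sp(1)I₂`, where
the quotient has the quotient topology and a manifold structure for which the quotient map is a
submersion. -/
def IsQuotientStructure (S : SmoothStructure 7 MoebiusB) : Prop :=
  letI := S.top
  letI := S.charts
  ∃ _ : ChartedSpace (EuclideanSpace ℝ (Fin 7)) (Sp11 ⧸ scalarSubgroup),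
    IsSmoothManifold (𝓡 7) (Sp11 ⧸ scalarSubgroup) ∧
    IsSurjSubmersion sp11ModelWithCorners (𝓡 7)
      (fun A : Sp11 => (A : Sp11 ⧸ scalarSubgroup)) ∧
    ∃ e : (Sp11 ⧸ scalarSubgroup) ≃ₘ^∞⟮𝓡 7, 𝓡 7⟯ MoebiusB,
      ∀ A : Sp11, e (A : Sp11 ⧸ scalarSubgroup) = moebiusProj A

/-- `A ↦ 𝓕_{A⁻¹}` is a principal fiber bundle with total space `Sp(1,1)`, base space `𝓜(𝔹)` with
the manifold structure `S`, and structure group `Sp(1)` acting by right translations. -/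
def IsMoebiusBundle (S : SmoothStructure 7 MoebiusB) : Prop :=
  letI := S.top
  letI := S.charts
  IsPrincipalFiberBundle sp11ModelWithCorners (𝓡 7) (𝓡 3) rightTranslation moebiusProj

end QuatMoebius

end

namespace QuatMoebius

/-! ### Power series expansions on the unit ball -/

/-! The geometry is elementary once `Sp(1,1)` is written in the parameters `(b, u, v)` of `ℍ × Sp(1)
× Sp(1)`: there a right translation by `g` multiplies all three on the right by `g`
(`sp11ToParam_rightTranslation`). Hence `(b u⁻¹, v u⁻¹)` is a complete invariant of the orbits
(`baseProj_eq_iff`), the matrices with `u = 1` form a global section, and `Sp(1,1)` is equivariantly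
`(ℍ × Sp(1)) × Sp(1)` (`trivialization`).

The analysis enters in two places. First, the fibers of `A ↦ 𝓕_{A⁻¹}` are these orbits
(`moebiusProj_eq_iff`): a left unit scalar cancels from every power series coefficient, and
conversely the coefficients of index 0 and 1 determine the matrix up to that scalar. Second,
`𝓕_A(q)` is a classical Möbius transformation evaluated at a conjugate of `q`, which keeps it in the
ball (`regularMoebius_mem_ball`).

So both the quotient and `𝓜(𝔹)` are in bijection with `ℍ × Sp(1)`, and transporting its structure
gives existence. For uniqueness, any admissible structure on the quotient is compared with `ℍ ×
Sp(1)`: the comparison map is a smooth homeomorphism with surjective differentials in equal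
dimension, hence a diffeomorphism by the inverse function theorem (`contMDiff_quotientHomeomorph`).
The bundle is then the global trivialization carried over to `𝓜(𝔹)`. -/

theorem HasExpansion.unique {f : UnitBall → ℍ[ℝ]} {a b : ℕ → ℍ[ℝ]} (ha : HasExpansion f a)
    (hb : HasExpansion f b) : a = b := by
  -- At real `t` the factor `tⁿ` is a central scalar, so the restriction to the real axis is an
  -- ordinary power series in one real variable, whose coefficients are unique.
  let p : (ℕ → ℍ[ℝ]) → FormalMultilinearSeries ℝ ℝ ℍ[ℝ] := fun a n =>
    ContinuousMultilinearMap.mkPiRing ℝ (Fin n) (a n)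
  have hp : ∀ a n, (p a).coeff n = a n := fun a n => by
    simp [p, FormalMultilinearSeries.coeff, ContinuousMultilinearMap.mkPiRing_apply]
  have key : ∀ a, HasExpansion f a → HasFPowerSeriesAt
      (fun t : ℝ => ∑' n, t ^ n • a n) (p a) 0 := by
    intro a ha
    rw [hasFPowerSeriesAt_iff]
    filter_upwards [Metric.ball_mem_nhds (0 : ℝ) one_pos] with t ht
    have h := ha ⟨(t : ℍ[ℝ]), by simpa using ht⟩
    simp only [hp, zero_add]
    simp only [← Quaternion.coe_pow, Quaternion.coe_mul_eq_smul] at h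
    exact h.summable.hasSum
  have hab : (fun t : ℝ => ∑' n, t ^ n • a n) =ᶠ[nhds 0] fun t : ℝ => ∑' n, t ^ n • b n := by
    filter_upwards [Metric.ball_mem_nhds (0 : ℝ) one_pos] with t ht
    have h1 := (ha ⟨(t : ℍ[ℝ]), by simpa using ht⟩).tsum_eq
    have h2 := (hb ⟨(t : ℍ[ℝ]), by simpa using ht⟩).tsum_eq
    have h3 := h1.trans h2.symm
    simpa only [← Quaternion.coe_pow, Quaternion.coe_mul_eq_smul] using h3
  have := ((key a ha).congr hab).eq_formalMultilinearSeries (key b hb)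
  funext n
  rw [← hp a, ← hp b, this]

theorem HasExpansion.coeff_eq {f : UnitBall → ℍ[ℝ]} {a : ℕ → ℍ[ℝ]} (h : HasExpansion f a) :
    coeff f = a := by
  have hex : ∃ a, HasExpansion f a := ⟨a, h⟩
  rw [coeff, dif_pos hex]
  exact hex.choose_spec.unique h

/-- The sequence `b, a, 0, 0, …`. -/
noncomputable def linearCoeff (a b : ℍ[ℝ]) : ℕ → ℍ[ℝ]
  | 0 => b
  | 1 => a
  | _ => 0

theorem hasExpansion_linear (a b : ℍ[ℝ]) : HasExpansion (linearFun a b) (linearCoeff a b) := by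
  intro q
  have h : HasSum (fun n => (q : ℍ[ℝ]) ^ n * linearCoeff a b n) _ :=
    hasSum_sum_of_ne_finset_zero (s := Finset.range 2) fun n hn => by
      obtain ⟨m, rfl⟩ : ∃ m, n = m + 2 := ⟨n - 2, by simp at hn; omega⟩
      simp [linearCoeff]
  convert h using 1
  simp [Finset.sum_range_succ, linearCoeff, linearFun, add_comm]

theorem coeff_linearFun (a b : ℍ[ℝ]) : coeff (linearFun a b) = linearCoeff a b :=
  (hasExpansion_linear a b).coeff_eq

theorem regularConj_linearFun (a b : ℍ[ℝ]) :
    regularConj (linearFun a b) = linearFun (star a) (star b) := by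
  funext q
  rw [regularConj, coeff_linearFun, ofCoeff, ← (hasExpansion_linear (star a) (star b) q).tsum_eq]
  congr 1 with n : 1
  rcases n with _ | _ | n <;> simp [linearCoeff]

theorem symmetrization_linearFun (c d : ℍ[ℝ]) (q : UnitBall) :
    symmetrization (linearFun c d) q =
      d * star d + q * (d * star c + c * star d) + (q : ℍ[ℝ]) ^ 2 * (c * star c) := by
  rw [symmetrization, regularConj_linearFun, starMul, coeff_linearFun, coeff_linearFun, ofCoeff,
    tsum_eq_sum (s := Finset.range 3)]
  · simp [Finset.sum_range_succ, linearCoeff]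
  · intro n hn
    obtain ⟨m, rfl⟩ : ∃ m, n = m + 3 := ⟨n - 3, by simp at hn; omega⟩
    rw [Finset.sum_eq_zero, mul_zero]
    intro k _
    rcases k with _ | _ | k
    · simp [linearCoeff]
    · rw [show m + 3 - (0 + 1) = m + 2 by omega]; simp [linearCoeff]
    · simp [linearCoeff]

/-- As `q` and `r` need not commute, there is no closed form `(1 - qr)⁻¹`. Splitting off the first
term and pulling `q` out on the left and `r` on the right gives a fixed-point equation, which
replaces the closed form in everything below. -/
theorem hasSum_geometric (q r : ℍ[ℝ]) (hq : ‖q‖ < 1) (hr : ‖r‖ < 1) :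
    ∃ S : ℍ[ℝ], HasSum (fun n => q ^ n * r ^ n) S ∧ S = 1 + q * S * r := by
  have hs : Summable fun n => q ^ n * r ^ n := by
    refine Summable.of_norm_bounded (g := fun n => ‖q‖ ^ n)
      (summable_geometric_of_lt_one (norm_nonneg _) hq) fun n => ?_
    rw [norm_mul, norm_pow, norm_pow]
    exact mul_le_of_le_one_right (by positivity) (pow_le_one₀ (norm_nonneg _) hr.le)
  refine ⟨_, hs.hasSum, ?_⟩
  conv_lhs => rw [hs.tsum_eq_zero_add]
  rw [← tsum_mul_left, ← tsum_mul_right]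
  simp [pow_succ', pow_succ r, mul_assoc]

/-- Both sums are twice a real part, and the real parts agree because `Re (xy) = Re (yx)` and `Re x̄
= Re x`. The first form appears in the symmetrization, the second in the cancellation that
identifies the regular reciprocal. -/
theorem exists_coe_eq_mul_star_add (c d : ℍ[ℝ]) :
    ∃ t : ℝ, d * star c + c * star d = t ∧ star d * c + star c * d = t := by
  refine ⟨2 * (d * star c).re, ?_, ?_⟩
  · rw [← Quaternion.self_add_star', star_mul, star_star]
  · rw [show star c * d = star (star d * c) by simp, Quaternion.self_add_star']
    congr 2
    simp only [Quaternion.re_mul, Quaternion.re_star, Quaternion.imI_star, Quaternion.imJ_star,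
      Quaternion.imK_star]
    ring

/-- The expansion of `(q c + d)^{-*}`. -/
theorem hasExpansion_starInv_linear (c d : ℍ[ℝ]) (h : ‖c‖ < ‖d‖) :
    HasExpansion (starInv (linearFun c d)) fun n => (-(d⁻¹ * c)) ^ n * d⁻¹ := by
  intro q
  have hd : d ≠ 0 := fun h0 => by
    rw [h0, norm_zero] at h
    exact absurd h (norm_nonneg _).not_gt
  have hq : ‖(q : ℍ[ℝ])‖ < 1 := mem_ball_zero_iff.mp q.2
  have hr : ‖-(d⁻¹ * c)‖ < 1 := by
    rw [norm_neg, norm_mul, norm_inv, inv_mul_lt_one₀ (norm_pos_iff.mpr hd)]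
    exact h
  obtain ⟨S, hS, hS1⟩ := hasSum_geometric q (-(d⁻¹ * c)) hq hr
  have hG := hS.mul_right d⁻¹
  simp only [mul_assoc] at hG
  obtain ⟨t, ht, ht'⟩ := exists_coe_eq_mul_star_add c d
  have hdr : d * -(d⁻¹ * c) = -c := by rw [mul_neg, mul_inv_cancel_left₀ hd]
  set r := -(d⁻¹ * c) with hrdef
  -- The candidate value `S d⁻¹` is checked by multiplying with `fˢ(q)`, whose coefficients `|d|²`,
  -- `t`, `|c|²` are real and hence central.
  have hsymm : symmetrization (linearFun c d) q * (S * d⁻¹) = regularConj (linearFun c d) q := by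
    rw [symmetrization_linearFun, regularConj_linearFun, linearFun, ht, Quaternion.self_mul_star,
      Quaternion.self_mul_star, ← mul_assoc, ← eq_mul_inv_iff_mul_eq₀ (inv_ne_zero hd), inv_inv]
    have hD : star d * d = ((Quaternion.normSq d : ℝ) : ℍ[ℝ]) := Quaternion.star_mul_self d
    have hC : r * (star c * d) = -((Quaternion.normSq c : ℝ) : ℍ[ℝ]) := by
      rw [hrdef, neg_mul, mul_assoc, ← mul_assoc c, Quaternion.self_mul_star,
        Quaternion.coe_commutes, inv_mul_cancel_left₀ hd]
    have hDr : ((Quaternion.normSq d : ℝ) : ℍ[ℝ]) * r = -(star d * c) := by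
      rw [← hD, mul_assoc, hdr, mul_neg]
    -- The recursion for `S` is inserted in `e1` and `e3`. On adding up, the terms `q S d̄ c` and
    -- `q² |c|² S` cancel and `|d|² + q c̄ d = (q c̄ + d̄) d` remains.
    have e1 : ((Quaternion.normSq d : ℝ) : ℍ[ℝ]) * S
        = Quaternion.normSq d - q * S * (star d * c) := by
      conv_lhs => rw [hS1, mul_add, mul_one, Quaternion.coe_commutes, mul_assoc,
        ← Quaternion.coe_commutes, hDr]
      noncomm_ring
    have e2 : (q : ℍ[ℝ]) * t * S = q * S * (star d * c) + q * S * (star c * d) := by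
      rw [mul_assoc, Quaternion.coe_commutes, ← ht']
      noncomm_ring
    have e3 : (q : ℍ[ℝ]) * S * (star c * d) = q * (star c * d)
        - (q : ℍ[ℝ]) ^ 2 * Quaternion.normSq c * S := by
      conv_lhs => rw [hS1, mul_add, mul_one, add_mul, mul_assoc, mul_assoc, mul_assoc, hC]
      rw [mul_assoc (_ ^ 2), Quaternion.coe_commutes]
      noncomm_ring
    rw [add_mul, add_mul, e1, e2, e3, add_mul, hD]
    noncomm_ring
  -- A zero of `fˢ` would force `d̄ = -q c̄`, so `|d| = |q| |c|`, against `|c| < |d|` and `|q| < 1`.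
  have hne : symmetrization (linearFun c d) q ≠ 0 := fun h0 => by
    rw [h0, zero_mul, regularConj_linearFun, linearFun] at hsymm
    have := congrArg norm (eq_neg_of_add_eq_zero_right hsymm.symm)
    rw [norm_neg, norm_mul, norm_star, norm_star] at this
    nlinarith [norm_nonneg c]
  rwa [starInv, ← hsymm, inv_mul_cancel_left₀ hne]

/-- The expansion of `(q c + d)^{-*} * (q a + b)`. -/
theorem hasExpansion_moebius (a b c d : ℍ[ℝ]) (h : ‖c‖ < ‖d‖) (q : UnitBall) : ∃ S : ℍ[ℝ],
    S = 1 + q * S * (-(d⁻¹ * c)) ∧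
    HasSum (fun n => (q : ℍ[ℝ]) ^ n * ∑ k ∈ Finset.range (n + 1),
      (-(d⁻¹ * c)) ^ k * d⁻¹ * linearCoeff a b (n - k)) (S * d⁻¹ * b + q * S * d⁻¹ * a) := by
  have hd : 0 < ‖d‖ := (norm_nonneg c).trans_lt h
  have hr : ‖-(d⁻¹ * c)‖ < 1 := by rwa [norm_neg, norm_mul, norm_inv, inv_mul_lt_one₀ hd]
  obtain ⟨S, hS, hS1⟩ := hasSum_geometric q (-(d⁻¹ * c)) (mem_ball_zero_iff.mp q.2) hr
  refine ⟨S, hS1, ?_⟩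
  have h1 := (hS.mul_right d⁻¹).mul_right b
  have h2 := (((hS.mul_left (q : ℍ[ℝ])).mul_right d⁻¹).mul_right a)
  -- The `a`-series is shifted by one power of `q`, so the constant term is split off; at index `n +
  -- 1` only `k = n` (with `a`) and `k = n + 1` (with `b`) survive.
  rw [← hasSum_nat_add_iff' 1] at h1 ⊢
  convert h1.add h2 using 1
  · funext n
    rw [Finset.sum_range_succ, Finset.sum_range_succ, Finset.sum_eq_zero]
    · rw [Nat.sub_self, show n + 1 - n = 1 by omega]
      simp only [linearCoeff]
      rw [zero_add, mul_add, add_comm, pow_succ' (q : ℍ[ℝ])]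
      simp only [mul_assoc]
    · intro k hk
      obtain ⟨m, hm⟩ : ∃ m, n + 1 - k = m + 2 :=
        ⟨n + 1 - k - 2, by have := Finset.mem_range.mp hk; omega⟩
      rw [hm]
      simp [linearCoeff]
  · simp [linearCoeff]
    abel

/-! ### Regular Möbius transformations -/

theorem Sp11.norm_c_lt_norm_d (A : Sp11) : ‖A.1 0 1‖ < ‖A.1 1 1‖ := by
  nlinarith [A.entries.2.1, norm_nonneg (A.1 0 1), norm_nonneg (A.1 1 1)]

/-- The coefficients of `𝓕_A`. -/
noncomputable def moebiusCoeff (A : Sp11) (n : ℕ) : ℍ[ℝ] :=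
  ∑ k ∈ Finset.range (n + 1), (-((A.1 1 1)⁻¹ * A.1 0 1)) ^ k * (A.1 1 1)⁻¹ *
    linearCoeff (A.1 0 0) (A.1 1 0) (n - k)

theorem regularMoebius_eq_ofCoeff (A : Sp11) : regularMoebius A = ofCoeff (moebiusCoeff A) := by
  rw [regularMoebius, starMul, coeff_linearFun,
    (hasExpansion_starInv_linear _ _ A.norm_c_lt_norm_d).coeff_eq]
  rfl

theorem hasExpansion_regularMoebius (A : Sp11) :
    HasExpansion (regularMoebius A) (moebiusCoeff A) := by
  intro q
  obtain ⟨S, -, hS⟩ := hasExpansion_moebius (A.1 0 0) (A.1 1 0) _ _ A.norm_c_lt_norm_d q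
  rw [regularMoebius_eq_ofCoeff]
  exact hS.summable.hasSum

theorem exists_regularMoebius_apply (A : Sp11) (q : UnitBall) : ∃ S : ℍ[ℝ],
    S = 1 + q * S * (-((A.1 1 1)⁻¹ * A.1 0 1)) ∧ regularMoebius A q =
      S * (A.1 1 1)⁻¹ * A.1 1 0 + q * S * (A.1 1 1)⁻¹ * A.1 0 0 := by
  obtain ⟨S, hS1, hS⟩ := hasExpansion_moebius (A.1 0 0) (A.1 1 0) _ _ A.norm_c_lt_norm_d q
  refine ⟨S, hS1, ?_⟩
  rw [regularMoebius_eq_ofCoeff]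
  exact hS.tsum_eq

theorem moebiusCoeff_zero (A : Sp11) : moebiusCoeff A 0 = (A.1 1 1)⁻¹ * A.1 1 0 := by
  simp [moebiusCoeff, linearCoeff]

/-- The convolution gives `d⁻¹ (a - c d⁻¹ b)`. Multiplying the bracket by `ā` on the left and using
`ā c = b̄ d` turns it into `|a|² - |b|² = 1`. -/
theorem moebiusCoeff_one (A : Sp11) :
    moebiusCoeff A 1 = (A.1 1 1)⁻¹ * (star (A.1 0 0))⁻¹ := by
  obtain ⟨h1, h2, h3⟩ := A.entries
  have ha : star (A.1 0 0) ≠ 0 := star_ne_zero.mpr A.a_ne_zero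
  have e : A.1 0 0 - A.1 0 1 * ((A.1 1 1)⁻¹ * A.1 1 0) = (star (A.1 0 0))⁻¹ := by
    rw [← mul_right_inj' ha, mul_inv_cancel₀ ha, mul_sub, ← mul_assoc (star _), h3, mul_assoc,
      mul_inv_cancel_left₀ A.d_ne_zero, Quaternion.star_mul_self, Quaternion.star_mul_self,
      ← Quaternion.coe_sub, Quaternion.normSq_eq_norm_mul_self, Quaternion.normSq_eq_norm_mul_self,
      ← pow_two, ← pow_two, h1, add_sub_cancel_right, Quaternion.coe_one]
  rw [← e, moebiusCoeff]
  simp only [Finset.sum_range_succ, Finset.range_zero, Finset.sum_empty, linearCoeff, pow_zero,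
    pow_one, Nat.sub_zero, Nat.sub_self]
  noncomm_ring

/-- Each coefficient involves the entries only through `d⁻¹ c`, `d⁻¹ a` and `d⁻¹ b`, in which a
common left factor cancels. -/
theorem moebiusCoeff_scalar_mul (u : Sp1) (A : Sp11) :
    moebiusCoeff (scalarHom u * A) = moebiusCoeff A := by
  have hu : (u : ℍ[ℝ]) ≠ 0 := ne_zero_of_mem_unit_sphere u
  have h : ∀ i j, (scalarHom u * A).1 i j = u * A.1 i j := fun i j =>
    Matrix.diagonal_mul (fun _ => (u : ℍ[ℝ])) A.1 i j
  funext n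
  refine Finset.sum_congr rfl fun k _ => ?_
  simp only [h, mul_inv_rev, mul_assoc, inv_mul_cancel_left₀ hu]
  congr 2
  rcases n - k with _ | _ | m <;> simp [linearCoeff, inv_mul_cancel_left₀ hu]

/-- With `T = d S⁻¹ q S d⁻¹`, a conjugate of `q` and so of the same norm, the recursion for `S`
yields `𝓕_A(q) = (d + T c)⁻¹ (b + T a)`. The rows of `A` satisfy the same kind of relations as its
columns, whence `|d + T c|² - |b + T a|² = 1 - |T|² > 0`. -/
theorem regularMoebius_mem_ball (A : Sp11) (q : UnitBall) :
    regularMoebius A q ∈ Metric.ball (0 : ℍ[ℝ]) 1 := by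
  obtain ⟨S, hS, hF⟩ := exists_regularMoebius_apply A q
  have hS0 : S ≠ 0 := by
    rintro rfl
    simp at hS
  have hd := A.d_ne_zero
  obtain ⟨T, hT⟩ : ∃ T, T = A.1 1 1 * S⁻¹ * q * S * (A.1 1 1)⁻¹ := ⟨_, rfl⟩
  have hTn : ‖T‖ < 1 := by
    have : ‖T‖ = ‖(q : ℍ[ℝ])‖ := by
      rw [hT]
      simp only [norm_mul, norm_inv]
      field_simp [norm_ne_zero_iff.mpr hd, norm_ne_zero_iff.mpr hS0]
    rw [this]
    exact mem_ball_zero_iff.mp q.2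
  have hqS : q * S * (A.1 1 1)⁻¹ = S * (A.1 1 1)⁻¹ * T := by
    rw [hT]
    simp only [← mul_assoc]
    rw [inv_mul_cancel_right₀ hd, mul_inv_cancel₀ hS0, one_mul]
  have e1 : regularMoebius A q = S * (A.1 1 1)⁻¹ * (A.1 1 0 + T * A.1 0 0) := by
    rw [hF, hqS, mul_add, ← mul_assoc _ T]
  have e2 : S * (A.1 1 1)⁻¹ * (A.1 1 1 + T * A.1 0 1) = 1 := by
    rw [mul_add, ← mul_assoc _ T, ← hqS, inv_mul_cancel_right₀ hd]
    conv_lhs => enter [1]; rw [hS]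
    noncomm_ring
  -- The relations between the rows: `b ā = d c̄` from `A I A* = I`, and `|a|² = 1 + |c|²`, `|d|² =
  -- 1 + |b|²` from the entries of `A⁻¹`.
  have hM := A.mul_signature_conjTranspose
  have h01 := congrFun (congrFun hM 1) 0
  have h00 := (A⁻¹).entries.1
  have h11 := (A⁻¹).entries.2.1
  simp [Sp11.coe_inv, signatureMatrix, Matrix.mul_apply, Fin.sum_univ_two, Matrix.vecMul,
    dotProduct] at h00 h11 h01
  have key : ‖A.1 1 1 + T * A.1 0 1‖ ^ 2 - ‖A.1 1 0 + T * A.1 0 0‖ ^ 2 = 1 - ‖T‖ ^ 2 := by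
    rw [norm_add_sq_real, norm_add_sq_real, norm_mul, norm_mul, mul_pow, mul_pow, h00, h11]
    have : inner ℝ (A.1 1 1) (T * A.1 0 1) = inner ℝ (A.1 1 0) (T * A.1 0 0) := by
      rw [Quaternion.inner_def, Quaternion.inner_def, star_mul, star_mul, ← mul_assoc, ← mul_assoc]
      congr 2
      exact (sub_eq_zero.mp (by simpa [sub_eq_add_neg] using h01)).symm
    rw [this]
    ring
  have hlt : ‖A.1 1 0 + T * A.1 0 0‖ < ‖A.1 1 1 + T * A.1 0 1‖ := by
    refine lt_of_pow_lt_pow_left₀ 2 (norm_nonneg _) ?_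
    nlinarith [norm_nonneg T]
  have h3 := congrArg norm e2
  rw [norm_mul, norm_one] at h3
  have hpos : 0 < ‖S * (A.1 1 1)⁻¹‖ := by
    rw [norm_pos_iff]
    exact mul_ne_zero hS0 (inv_ne_zero hd)
  rw [mem_ball_zero_iff, e1, norm_mul, ← h3]
  exact mul_lt_mul_of_pos_left hlt hpos

theorem Sp11.inv_entries (A : Sp11) : (A⁻¹).1 = !![star (A.1 0 0), -star (A.1 1 0);
    -star (A.1 0 1), star (A.1 1 1)] := by
  ext i j : 1
  fin_cases i <;> fin_cases j <;> simp [Sp11.coe_inv, signatureMatrix, Matrix.mul_apply,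
    Fin.sum_univ_two, Matrix.vecMul, dotProduct]

theorem star_Sp1 (u : Sp1) : star (u : ℍ[ℝ]) = (u : ℍ[ℝ])⁻¹ := by
  refine eq_inv_of_mul_eq_one_left ?_
  rw [Quaternion.star_mul_self, Quaternion.normSq_eq_norm_mul_self, norm_Sp1, mul_one,
    Quaternion.coe_one]

/-- The first two coefficients of `𝓕_{A⁻¹}` determine `A` up to a unit quaternion. -/
theorem exists_scalar_of_moebiusCoeff_eq {A B : Sp11}
    (h : moebiusCoeff A⁻¹ = moebiusCoeff B⁻¹) : ∃ u : Sp1, rightTranslation A u = B := by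
  have h0 := congrFun h 0
  have h1 := congrFun h 1
  -- The entry `c` is redundant. The coefficient of index 0 yields `b a⁻¹`, and the one of index 1
  -- yields `d` once `a` is known.
  have hc : ∀ A : Sp11, A.1 0 1 = (star (A.1 0 0))⁻¹ * (star (A.1 1 0) * A.1 1 1) := fun A => by
    rw [← A.entries.2.2, inv_mul_cancel_left₀ (star_ne_zero.mpr A.a_ne_zero)]
  have hb : ∀ A : Sp11, moebiusCoeff A⁻¹ 0 = -(A.1 1 0 * (A.1 0 0)⁻¹) := fun A => by
    rw [moebiusCoeff_zero]
    simp only [Sp11.inv_entries, Matrix.of_apply, Matrix.cons_val', Matrix.cons_val_zero,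
      Matrix.cons_val_one, Matrix.cons_val_fin_one]
    rw [hc A, star_mul, star_mul, star_star, mul_neg, ← mul_assoc,
      inv_mul_cancel_left₀ (star_ne_zero.mpr A.d_ne_zero), star_inv₀, star_star]
  have hd : ∀ A : Sp11, A.1 1 1 = star ((A.1 0 0)⁻¹ * (moebiusCoeff A⁻¹ 1)⁻¹) := fun A => by
    rw [moebiusCoeff_one]
    simp [Sp11.inv_entries, A.a_ne_zero]
  rw [hb, hb, neg_inj] at h0
  have hA := A.a_ne_zero
  have hB := B.a_ne_zero
  -- Since `|a|² = 1 + |b|²`, the number `|b a⁻¹|² = 1 - |a|⁻²` determines `|a|`; this makes the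
  -- quotient of the two `a`-entries a unit quaternion.
  have hn : ‖A.1 0 0‖ = ‖B.1 0 0‖ := by
    have e := congrArg (‖·‖ ^ 2) h0
    simp only [norm_mul, mul_pow, norm_inv, inv_pow] at e
    have eA := A.entries.1
    have eB := B.entries.1
    have pA := norm_pos_iff.mpr hA
    have pB := norm_pos_iff.mpr hB
    refine (pow_left_inj₀ pA.le pB.le two_ne_zero).mp ?_
    field_simp at e
    nlinarith
  obtain ⟨u, hu'⟩ : ∃ u : Sp1, (u : ℍ[ℝ]) = (A.1 0 0)⁻¹ * B.1 0 0 := ⟨⟨(A.1 0 0)⁻¹ * B.1 0 0, by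
    rw [mem_sphere_zero_iff_norm, norm_mul, norm_inv, hn,
      inv_mul_cancel₀ (norm_ne_zero_iff.mpr hB)]⟩, rfl⟩
  have hu0 : (u : ℍ[ℝ]) ≠ 0 := ne_zero_of_mem_unit_sphere u
  have hu : star (u : ℍ[ℝ]) = (u : ℍ[ℝ])⁻¹ := star_Sp1 u
  have ea : B.1 0 0 = A.1 0 0 * u := by rw [hu', mul_inv_cancel_left₀ hA]
  have eb : B.1 1 0 = A.1 1 0 * u := by
    rw [← inv_mul_cancel_right₀ hB (B.1 1 0), ← h0, mul_assoc, hu']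
  have ed : B.1 1 1 = A.1 1 1 * u := by
    rw [hd B, hd A, ← h1, ea, mul_inv_rev, mul_assoc, star_mul, ← hu, star_star]
  have ec : B.1 0 1 = A.1 0 1 * u := by
    rw [hc B, hc A, ed, eb, ea, star_mul, star_mul, mul_inv_rev, hu, inv_inv]
    simp only [mul_assoc, mul_inv_cancel_left₀ hu0]
  refine ⟨u, Subtype.ext ?_⟩
  ext i j : 1
  rw [rightTranslation, Sp11.coe_mul]
  refine (Matrix.mul_diagonal (fun _ => (u : ℍ[ℝ])) A.1 i j).trans ?_
  fin_cases i <;> fin_cases j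
  exacts [ea.symm, ec.symm, eb.symm, ed.symm]

theorem moebiusProj_eq_iff {A B : Sp11} :
    moebiusProj A = moebiusProj B ↔ ∃ u : Sp1, rightTranslation A u = B := by
  refine ⟨fun h => exists_scalar_of_moebiusCoeff_eq ?_, ?_⟩
  · have h' : regularMoebius A⁻¹ = regularMoebius B⁻¹ := congrArg Subtype.val h
    exact (h' ▸ hasExpansion_regularMoebius A⁻¹).unique (hasExpansion_regularMoebius B⁻¹)
  · rintro ⟨u, rfl⟩
    refine Subtype.ext ?_
    change regularMoebius A⁻¹ = regularMoebius (A * scalarHom u)⁻¹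
    rw [mul_inv_rev, ← map_inv, regularMoebius_eq_ofCoeff, regularMoebius_eq_ofCoeff,
      moebiusCoeff_scalar_mul]

/-! ### Smooth homeomorphisms and transported manifold structures -/

section Generic

variable {E : Type*} [NormedAddCommGroup E] [NormedSpace ℝ E] {H : Type*} [TopologicalSpace H]
  {I : ModelWithCorners ℝ E H} {M : Type*} [TopologicalSpace M] [ChartedSpace H M]
  {E' : Type*} [NormedAddCommGroup E'] [NormedSpace ℝ E'] {H' : Type*} [TopologicalSpace H']
  {J : ModelWithCorners ℝ E' H'} {N : Type*} [TopologicalSpace N] [ChartedSpace H' N]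

/-- A map with a smooth section through `p` has surjective differential at `p`. -/
theorem surjective_mfderiv_of_section {f : M → N} {s : N → M} {p : M}
    (hf : MDifferentiableAt I J f p) (hs : MDifferentiableAt J I s (f p)) (hsp : s (f p) = p)
    (hfs : ∀ y, f (s y) = y) : Function.Surjective (mfderiv I J f p) := by
  have hf' : MDifferentiableAt I J f (s (f p)) := hsp.symm ▸ hf
  have h := mfderiv_comp (f p) hf' hs
  rw [show f ∘ s = id from funext hfs, mfderiv_id] at h
  rw [hsp] at h
  intro v
  exact ⟨_, (congrArg (fun L => L v) h).symm⟩

/-- If the differential of `g ∘ f` is surjective, so is that of `g`. -/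
theorem surjective_mfderiv_of_comp {E'' : Type*} [NormedAddCommGroup E''] [NormedSpace ℝ E'']
    {H'' : Type*} [TopologicalSpace H''] {K : ModelWithCorners ℝ E'' H''} {P : Type*}
    [TopologicalSpace P] [ChartedSpace H'' P] {f : M → N} {g : N → P} {x : M} {y : N}
    (hxy : f x = y) (hg : MDifferentiableAt J K g y) (hf : MDifferentiableAt I J f x)
    (h : Function.Surjective (mfderiv I K (g ∘ f) x)) : Function.Surjective (mfderiv J K g y) := by
  subst hxy
  rw [mfderiv_comp x hg hf] at h
  exact Function.Surjective.of_comp h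

/-- A map that becomes a diffeomorphism in the same coordinates on both sides is smooth. -/
theorem contMDiff_of_diffeomorph {E'' : Type*} [NormedAddCommGroup E''] [NormedSpace ℝ E'']
    {H'' : Type*} [TopologicalSpace H''] {K : ModelWithCorners ℝ E'' H''} {P : Type*}
    [TopologicalSpace P] [ChartedSpace H'' P] (D : P ≃ₘ^∞⟮K, I⟯ M) (D' : P ≃ₘ^∞⟮K, J⟯ N)
    {f : M → N} (hf : ∀ z, f (D z) = D' z) : ContMDiff I J ∞ f := by
  rw [show f = D' ∘ D.symm from funext fun x => by simp [← hf]]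
  exact D'.contMDiff.comp D.symm.contMDiff

/-- A smooth homeomorphism between manifolds of the same dimension all of whose differentials are
surjective is a diffeomorphism. -/
theorem contMDiff_symm_of_surjective_mfderiv [FiniteDimensional ℝ E] [FiniteDimensional ℝ E']
    (hdim : Module.finrank ℝ E = Module.finrank ℝ E') [I.Boundaryless] [J.Boundaryless]
    [IsManifold I ∞ M] [IsManifold J ∞ N] (h : M ≃ₜ N) (hh : ContMDiff I J ∞ h)
    (hsurj : ∀ x, Function.Surjective (mfderiv I J h x)) : ContMDiff J I ∞ h.symm := by
  intro y
  obtain ⟨x, rfl⟩ := h.surjective y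
  have : CompleteSpace E := FiniteDimensional.complete ℝ E
  -- The expression of `h` in charts, extended to the vector spaces because models without boundary
  -- are homeomorphisms. As `e` is already a local homeomorphism, an invertible derivative is enough
  -- for its inverse to be smooth.
  let e : OpenPartialHomeomorph E E' :=
    (((I.toHomeomorph.symm.toOpenPartialHomeomorph ≫ₕ (chartAt H x).symm) ≫ₕ
      h.toOpenPartialHomeomorph) ≫ₕ chartAt H' (h x)) ≫ₕ J.toHomeomorph.toOpenPartialHomeomorph
  have he : (e : E → E') = writtenInExtChartAt I J x h := rfl
  have hx : extChartAt I x x ∈ e.source := by simp [e]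
  have hex : e (extChartAt I x x) = extChartAt J (h x) (h x) := by simp [he, writtenInExtChartAt]
  have hy : extChartAt J (h x) (h x) ∈ e.target := hex ▸ e.map_source hx
  have hxy : e.symm (extChartAt J (h x) (h x)) = extChartAt I x x := by
    rw [← hex, e.left_inv hx]
  have hc : ContDiffAt ℝ ∞ e (extChartAt I x x) := by
    have := (contMDiffAt_iff.mp (hh x)).2
    rw [I.range_eq_univ, contDiffWithinAt_univ] at this
    exact this
  have hd : DifferentiableAt ℝ e (extChartAt I x x) := hc.differentiableAt (by simp)
  have hs : Function.Surjective (fderiv ℝ e (extChartAt I x x)) := by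
    have h1 : mfderiv I J h x = fderivWithin ℝ (writtenInExtChartAt I J x h) (Set.range I)
        (extChartAt I x x) := (hh.mdifferentiable (by simp) x).mfderiv
    rw [he, ← fderivWithin_univ, ← I.range_eq_univ, ← h1]
    exact hsurj x
  let L : E ≃L[ℝ] E' := (LinearEquiv.ofBijective (fderiv ℝ e (extChartAt I x x) : E →ₗ[ℝ] E')
    ⟨(LinearMap.injective_iff_surjective_of_finrank_eq_finrank hdim).mpr hs, hs⟩
      ).toContinuousLinearEquiv
  have hL : HasFDerivAt e (L : E →L[ℝ] E') (extChartAt I x x) := hd.hasFDerivAt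
  have key := e.contDiffAt_symm (n := ∞) hy (hxy.symm ▸ hL) (hxy.symm ▸ hc)
  rw [contMDiffAt_iff_of_mem_source (x := h x) (y := x) (mem_chart_source _ _) (by simp)]
  refine ⟨h.symm.continuous.continuousAt, ?_⟩
  rw [J.range_eq_univ, contDiffWithinAt_univ]
  exact key

variable {X : Type*} [TopologicalSpace X]

/-- The homeomorphism between the model spaces given by a linear equivalence. -/
noncomputable def modelHomeomorph (I : ModelWithCorners ℝ E H) [I.Boundaryless] (L : E ≃L[ℝ] E') :
    H ≃ₜ E' :=
  I.toHomeomorph.trans L.toHomeomorph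

/-- The manifold structure on `X` transported from `M` along a homeomorphism, with charts in the
vector space `E'`. -/
noncomputable abbrev transportedChartedSpace (I : ModelWithCorners ℝ E H) [I.Boundaryless]
    (L : E ≃L[ℝ] E') (Φ : X ≃ₜ M) : ChartedSpace E' X where
  atlas := {e | ∃ f ∈ atlas H M, e = (Φ.toOpenPartialHomeomorph ≫ₕ f) ≫ₕ
    (modelHomeomorph I L).toOpenPartialHomeomorph}
  chartAt x := (Φ.toOpenPartialHomeomorph ≫ₕ chartAt H (Φ x)) ≫ₕ
    (modelHomeomorph I L).toOpenPartialHomeomorph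
  mem_chart_source x := by simp
  chart_mem_atlas x := ⟨_, chart_mem_atlas _ _, rfl⟩

/-- Between transported charts `Φ` cancels, so the transition maps are those of `M` conjugated by
the linear map `L`. -/
theorem isManifold_transported [I.Boundaryless] (L : E ≃L[ℝ] E') (Φ : X ≃ₜ M) [IsManifold I ∞ M] :
    letI := transportedChartedSpace I L Φ
    IsManifold 𝓘(ℝ, E') ∞ X := by
  let := transportedChartedSpace I L Φ
  refine isManifold_of_contDiffOn _ _ _ ?_
  rintro _ _ ⟨f, hf, rfl⟩ ⟨g, hg, rfl⟩
  have h := (contDiffGroupoid ∞ I).compatible hf hg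
  rw [contDiffGroupoid, mem_groupoid_of_pregroupoid] at h
  have h1 : ContDiffOn ℝ ∞ (I ∘ (f.symm ≫ₕ g) ∘ I.symm)
    (I.symm ⁻¹' (f.symm ≫ₕ g).source ∩ Set.range I) := h.1
  refine (L.contDiff.comp_contDiffOn (h1.comp L.symm.contDiff.contDiffOn ?_)).congr ?_
  · rintro z ⟨hz, -⟩
    have hI : ∃ y, I y = L.symm z := I.toHomeomorph.surjective _
    simpa [modelHomeomorph, hI] using hz
  · intro z _
    simp [modelHomeomorph]

/-- In charts, `Φ` and its inverse read as the identity of `M` composed with `L⁻¹` on the right or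
with `L` on the left. -/
theorem contMDiff_transported [I.Boundaryless] (L : E ≃L[ℝ] E') (Φ : X ≃ₜ M) [IsManifold I ∞ M] :
    letI := transportedChartedSpace I L Φ
    ContMDiff 𝓘(ℝ, E') I ∞ Φ ∧ ContMDiff I 𝓘(ℝ, E') ∞ Φ.symm := by
  let := transportedChartedSpace I L Φ
  have := isManifold_transported L Φ (I := I)
  have hid := (contMDiff_iff.mp (contMDiff_id (I := I) (n := ∞) (M := M))).2
  have hchart : ∀ x : X, chartAt E' x = (Φ.toOpenPartialHomeomorph ≫ₕ chartAt H (Φ x)) ≫ₕ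
    (modelHomeomorph I L).toOpenPartialHomeomorph := fun _ => rfl
  have hI : ∀ z, ∃ y, I y = z := I.toHomeomorph.surjective
  constructor
  · rw [contMDiff_iff]
    refine ⟨Φ.continuous, fun x y => ?_⟩
    refine ((hid (Φ x) y).comp L.symm.contDiff.contDiffOn ?_).congr ?_
    · rintro z hz
      simpa [modelHomeomorph, extChartAt, hchart, hI] using hz
    · intro z _
      simp [modelHomeomorph, extChartAt, hchart]
  · rw [contMDiff_iff]
    refine ⟨Φ.symm.continuous, fun x y => ?_⟩
    refine (L.contDiff.comp_contDiffOn ((hid x (Φ y)).mono ?_)).congr ?_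
    · rintro z hz
      simpa [modelHomeomorph, extChartAt, hchart, hI] using hz
    · intro z _
      simp [modelHomeomorph, extChartAt, hchart]

/-- The transported structure makes the homeomorphism a diffeomorphism. -/
noncomputable def transportedDiffeomorph [I.Boundaryless] (L : E ≃L[ℝ] E') (Φ : X ≃ₜ M)
    [IsManifold I ∞ M] :
    letI := transportedChartedSpace I L Φ
    X ≃ₘ^∞⟮𝓘(ℝ, E'), I⟯ M :=
  letI := transportedChartedSpace I L Φ
  { Φ.toEquiv with
    contMDiff_toFun := (contMDiff_transported L Φ).1
    contMDiff_invFun := (contMDiff_transported L Φ).2 }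

theorem isSmoothManifold_transported [I.Boundaryless] [FiniteDimensional ℝ E'] (L : E ≃L[ℝ] E')
    (Φ : X ≃ₜ M) [IsManifold I ∞ M] [T2Space M] [SecondCountableTopology M] :
    letI := transportedChartedSpace I L Φ
    IsSmoothManifold 𝓘(ℝ, E') X :=
  letI := transportedChartedSpace I L Φ
  { finiteDimensional := inferInstance
    boundaryless := inferInstance
    isManifold := isManifold_transported L Φ
    t2 := Φ.isEmbedding.t2Space
    secondCountable := Φ.isEmbedding.secondCountableTopology }

end Generic

/-! ### `Sp(1)` is a Lie group -/

theorem coe_inv_Sp1 (u : Sp1) : ((u⁻¹ : Sp1) : ℍ[ℝ]) = star (u : ℍ[ℝ]) := (star_Sp1 u).symm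

instance : LieGroup (𝓡 3) ∞ Sp1 where
  contMDiff_mul := by
    have hmul : ContDiff ℝ ∞ fun p : ℍ[ℝ] × ℍ[ℝ] => p.1 * p.2 := contDiff_mul
    have h1 : ContMDiff ((𝓡 3).prod (𝓡 3)) 𝓘(ℝ, ℍ[ℝ]) ∞ fun p : Sp1 × Sp1 => (p.1 : ℍ[ℝ]) :=
      contMDiff_coe_sphere.comp contMDiff_fst
    have h2 : ContMDiff ((𝓡 3).prod (𝓡 3)) 𝓘(ℝ, ℍ[ℝ]) ∞ fun p : Sp1 × Sp1 => (p.2 : ℍ[ℝ]) :=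
      contMDiff_coe_sphere.comp contMDiff_snd
    exact (hmul.contMDiff.comp (h1.prodMk_space h2)).codRestrict_sphere fun p => (p.1 * p.2).2
  contMDiff_inv := by
    have h : ContMDiff (𝓡 3) 𝓘(ℝ, ℍ[ℝ]) ∞ fun u : Sp1 => star (u : ℍ[ℝ]) :=
      contDiff_star_quaternion.contMDiff.comp contMDiff_coe_sphere
    simp only [← coe_inv_Sp1] at h
    exact h.codRestrict_sphere fun u => (u⁻¹).2

theorem isSmoothManifold_Sp1 : IsSmoothManifold (𝓡 3) Sp1 where
  finiteDimensional := inferInstance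
  boundaryless := inferInstance
  isManifold := inferInstance
  t2 := inferInstance
  secondCountable := inferInstance

theorem isSmoothManifold_Sp11 : IsSmoothManifold sp11ModelWithCorners Sp11 where
  finiteDimensional := inferInstance
  boundaryless := inferInstance
  isManifold := inferInstance
  t2 := sp11Homeomorph.isEmbedding.t2Space
  secondCountable := sp11Homeomorph.isEmbedding.secondCountableTopology

/-! ### The global trivialization of the right translations -/

/-- The product `ℍ × Sp(1)`, onto which the quotient `Sp(1,1) / Sp(1)I₂` is mapped
diffeomorphically. -/
abbrev BaseParam : Type := ℍ[ℝ] × Sp1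

/-- The model of `ℍ × Sp(1)`. -/
noncomputable abbrev baseModelWithCorners : ModelWithCorners ℝ (ℍ[ℝ] × EuclideanSpace ℝ (Fin 3))
    (ModelProd ℍ[ℝ] (EuclideanSpace ℝ (Fin 3))) :=
  𝓘(ℝ, ℍ[ℝ]).prod (𝓡 3)

theorem Sp11.mul_scalarHom_apply (A : Sp11) (u : Sp1) (i j : Fin 2) :
    (rightTranslation A u).1 i j = A.1 i j * u :=
  Matrix.mul_diagonal (fun _ => (u : ℍ[ℝ])) A.1 i j

/-- Unit factors leave `|a|` and `|d|` unchanged, so normalizing commutes with the translation and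
the action becomes diagonal. The second parameter then records the group element, which is why the
bundle is globally trivial. -/
theorem sp11ToParam_rightTranslation (A : Sp11) (u : Sp1) :
    sp11ToParam (rightTranslation A u) =
      ((sp11ToParam A).1 * u, (sp11ToParam A).2.1 * u, (sp11ToParam A).2.2 * u) := by
  refine Prod.ext ?_ (Prod.ext (Subtype.ext ?_) (Subtype.ext ?_))
  · exact A.mul_scalarHom_apply u 1 0
  · simp [sp11ToParam, Sp11.mul_scalarHom_apply]
  · simp [sp11ToParam, Sp11.mul_scalarHom_apply]

theorem rightTranslation_one (A : Sp11) : rightTranslation A 1 = A := by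
  rw [rightTranslation, map_one, mul_one]

theorem rightTranslation_mul (A : Sp11) (u v : Sp1) :
    rightTranslation A (u * v) = rightTranslation (rightTranslation A u) v := by
  rw [rightTranslation, map_mul, ← mul_assoc]
  rfl

theorem contMDiff_rightTranslation : ContMDiff (sp11ModelWithCorners.prod (𝓡 3))
    sp11ModelWithCorners ∞ fun x : Sp11 × Sp1 => rightTranslation x.1 x.2 := by
  have hmul : ContDiff ℝ ∞ fun p : ℍ[ℝ] × ℍ[ℝ] => p.1 * p.2 := contDiff_mul
  rw [Sp11.contMDiff_iff]
  intro i j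
  simp only [Sp11.mul_scalarHom_apply]
  exact hmul.contMDiff.comp (((Sp11.contMDiff_entry i j).comp contMDiff_fst).prodMk_space
    (contMDiff_coe_sphere.comp contMDiff_snd))

/-- The invariants `(b u⁻¹, v u⁻¹)` of the matrix with parameters `(b, u, v)`. -/
noncomputable def baseProj (A : Sp11) : BaseParam :=
  ((sp11ToParam A).1 * ((sp11ToParam A).2.1⁻¹ : Sp1), (sp11ToParam A).2.2 * (sp11ToParam A).2.1⁻¹)

/-- The matrix with parameters `(x, 1, y)`. -/
noncomputable def baseSection (z : BaseParam) : Sp11 := sp11OfParam (z.1, 1, z.2)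

theorem contMDiff_baseSection :
    ContMDiff baseModelWithCorners sp11ModelWithCorners ∞ baseSection := by
  have h : ContMDiff baseModelWithCorners sp11ModelWithCorners ∞
      fun z : BaseParam => ((z.1, 1, z.2) : Sp11Param) :=
    contMDiff_fst.prodMk (contMDiff_const.prodMk contMDiff_snd)
  exact contMDiff_sp11Homeomorph_symm.comp h

theorem contMDiff_unitParam :
    ContMDiff sp11ModelWithCorners (𝓡 3) ∞ fun A : Sp11 => (sp11ToParam A).2.1 := by
  have h : ContMDiff sp11ModelWithCorners (𝓡 3) ∞ fun x : Sp11Param => x.2.1 :=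
    contMDiff_fst.comp contMDiff_snd
  exact h.comp contMDiff_sp11Homeomorph

theorem contMDiff_baseProj : ContMDiff sp11ModelWithCorners baseModelWithCorners ∞ baseProj := by
  have hmul : ContDiff ℝ ∞ fun p : ℍ[ℝ] × ℍ[ℝ] => p.1 * p.2 := contDiff_mul
  have hb : ContMDiff sp11ModelWithCorners 𝓘(ℝ, ℍ[ℝ]) ∞ fun x : Sp11Param => x.1 := contMDiff_fst
  have hu : ContMDiff sp11ModelWithCorners (𝓡 3) ∞ fun x : Sp11Param => x.2.1⁻¹ :=
    ContMDiff.inv (contMDiff_fst.comp contMDiff_snd)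
  have hv : ContMDiff sp11ModelWithCorners (𝓡 3) ∞ fun x : Sp11Param => x.2.2 :=
    contMDiff_snd.comp contMDiff_snd
  have h : ContMDiff sp11ModelWithCorners baseModelWithCorners ∞
      fun x : Sp11Param => ((x.1 * (x.2.1⁻¹ : Sp1), x.2.2 * x.2.1⁻¹) : BaseParam) :=
    (hmul.contMDiff.comp (hb.prodMk_space (contMDiff_coe_sphere.comp hu))).prodMk (hv.mul hu)
  exact h.comp contMDiff_sp11Homeomorph

theorem baseProj_rightTranslation_section (z : BaseParam) (g : Sp1) :
    baseProj (rightTranslation (baseSection z) g) = z := by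
  obtain ⟨x, y⟩ := z
  have hg : (g : ℍ[ℝ]) ≠ 0 := ne_zero_of_mem_unit_sphere g
  simp [baseProj, sp11ToParam_rightTranslation, baseSection, sp11ToParam_ofParam, hg]

theorem unitParam_rightTranslation_section (z : BaseParam) (g : Sp1) :
    (sp11ToParam (rightTranslation (baseSection z) g)).2.1 = g := by
  simp [sp11ToParam_rightTranslation, baseSection, sp11ToParam_ofParam]

theorem rightTranslation_section_baseProj (A : Sp11) :
    rightTranslation (baseSection (baseProj A)) (sp11ToParam A).2.1 = A := by
  refine sp11Homeomorph.injective ?_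
  change sp11ToParam _ = sp11ToParam A
  have hg : ((sp11ToParam A).2.1 : ℍ[ℝ]) ≠ 0 := ne_zero_of_mem_unit_sphere _
  simp [baseProj, sp11ToParam_rightTranslation, baseSection, sp11ToParam_ofParam, hg]

theorem contMDiff_rightTranslation_section :
    ContMDiff (baseModelWithCorners.prod (𝓡 3)) sp11ModelWithCorners ∞
      fun x : BaseParam × Sp1 => rightTranslation (baseSection x.1) x.2 := by
  have h1 : ContMDiff (baseModelWithCorners.prod (𝓡 3)) sp11ModelWithCorners ∞
      fun x : BaseParam × Sp1 => baseSection x.1 := contMDiff_baseSection.comp contMDiff_fst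
  have h2 : ContMDiff (baseModelWithCorners.prod (𝓡 3)) (𝓡 3) ∞
      fun x : BaseParam × Sp1 => x.2 := contMDiff_snd
  have h : ContMDiff (baseModelWithCorners.prod (𝓡 3)) (sp11ModelWithCorners.prod (𝓡 3)) ∞
      fun x : BaseParam × Sp1 => (baseSection x.1, x.2) := h1.prodMk h2
  have h' := contMDiff_rightTranslation.comp h
  exact h'

-- From here on only the smoothness of the two maps and the identities proved above matter.
attribute [irreducible] baseProj baseSection

/-- `((x, y), g) ↦` the matrix with parameters `(x g, g, y g)`, a global equivariant trivialization
of `Sp(1,1)`. -/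
noncomputable def trivialization :
    (BaseParam × Sp1) ≃ₘ^∞⟮baseModelWithCorners.prod (𝓡 3), sp11ModelWithCorners⟯ Sp11 where
  toFun x := rightTranslation (baseSection x.1) x.2
  invFun A := (baseProj A, (sp11ToParam A).2.1)
  left_inv x := Prod.ext (baseProj_rightTranslation_section x.1 x.2)
    (unitParam_rightTranslation_section x.1 x.2)
  right_inv A := rightTranslation_section_baseProj A
  contMDiff_toFun := contMDiff_rightTranslation_section
  contMDiff_invFun := contMDiff_baseProj.prodMk contMDiff_unitParam

theorem trivialization_apply (z : BaseParam) (g : Sp1) :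
    trivialization (z, g) = rightTranslation (baseSection z) g := rfl

theorem baseProj_section (z : BaseParam) : baseProj (baseSection z) = z := by
  simpa only [rightTranslation_one] using baseProj_rightTranslation_section z 1

theorem exists_rightTranslation_section (A : Sp11) :
    ∃ g, rightTranslation (baseSection (baseProj A)) g = A :=
  ⟨_, rightTranslation_section_baseProj A⟩

/-- Every matrix is a translate of the section point over its invariant. Two matrices over one
point, translates by `g` and `h`, differ by `g⁻¹ h`. -/
theorem baseProj_eq_iff {A B : Sp11} :
    baseProj A = baseProj B ↔ ∃ u, rightTranslation A u = B := by
  obtain ⟨g, hg⟩ := exists_rightTranslation_section A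
  obtain ⟨h, hh⟩ := exists_rightTranslation_section B
  constructor
  · intro e
    refine ⟨g⁻¹ * h, ?_⟩
    have hA : rightTranslation A g⁻¹ = baseSection (baseProj A) := by
      conv_lhs => rw [← hg, ← rightTranslation_mul, mul_inv_cancel, rightTranslation_one]
    rw [rightTranslation_mul, hA, e, hh]
  · rintro ⟨u, rfl⟩
    conv_rhs => rw [← hg, ← rightTranslation_mul]
    rw [baseProj_rightTranslation_section]

/-! ### The quotient and `𝓜(𝔹)` as manifolds -/

/-- `Sp(1,1) / Sp(1)I₂` is homeomorphic to `ℍ × Sp(1)`. -/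
noncomputable def quotientHomeomorph : (Sp11 ⧸ scalarSubgroup) ≃ₜ BaseParam where
  toFun := Quotient.lift baseProj fun A B h => by
    obtain ⟨u, hu⟩ := QuotientGroup.leftRel_apply.mp h
    exact baseProj_eq_iff.mpr ⟨u, by rw [rightTranslation, hu, mul_inv_cancel_left]⟩
  invFun z := (baseSection z : Sp11 ⧸ scalarSubgroup)
  left_inv x := by
    induction x using QuotientGroup.induction_on with | H A => ?_
    obtain ⟨g, hg⟩ := exists_rightTranslation_section A
    refine QuotientGroup.eq.mpr ⟨g, ?_⟩
    rw [eq_inv_mul_iff_mul_eq]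
    exact hg
  right_inv z := baseProj_section z
  continuous_toFun := contMDiff_baseProj.continuous.quotient_lift _
  continuous_invFun := QuotientGroup.continuous_mk.comp contMDiff_baseSection.continuous

theorem quotientHomeomorph_symm_baseProj (A : Sp11) :
    quotientHomeomorph.symm (baseProj A) = (A : Sp11 ⧸ scalarSubgroup) :=
  quotientHomeomorph.symm_apply_apply (A : Sp11 ⧸ scalarSubgroup)

/-- `𝓜(𝔹)` is in bijection with `ℍ × Sp(1)`. -/
noncomputable def moebiusEquiv : BaseParam ≃ MoebiusB :=
  .ofBijective (fun z => moebiusProj (baseSection z)) <| by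
    constructor
    · intro z w h
      rw [← baseProj_section z, ← baseProj_section w]
      exact baseProj_eq_iff.mpr (moebiusProj_eq_iff.mp h)
    · rintro ⟨_, A, rfl⟩
      -- The inverse appears because the projection sends a matrix to the transformation of its
      -- inverse.
      refine ⟨baseProj A⁻¹, ?_⟩
      refine (moebiusProj_eq_iff.mpr (exists_rightTranslation_section A⁻¹)).trans ?_
      exact Subtype.ext (congrArg regularMoebius (inv_inv A))

theorem moebiusEquiv_baseProj (A : Sp11) : moebiusEquiv (baseProj A) = moebiusProj A :=
  moebiusProj_eq_iff.mpr (exists_rightTranslation_section A)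

theorem finrank_baseModel : Module.finrank ℝ (ℍ[ℝ] × EuclideanSpace ℝ (Fin 3)) = 7 := by
  rw [Module.finrank_prod, Quaternion.finrank_eq_four, finrank_euclideanSpace_fin]

/-- A linear identification of the model space of `ℍ × Sp(1)` with `ℝ⁷`. -/
noncomputable def baseModelEquiv :
    (ℍ[ℝ] × EuclideanSpace ℝ (Fin 3)) ≃L[ℝ] EuclideanSpace ℝ (Fin 7) :=
  .ofFinrankEq (by rw [finrank_baseModel, finrank_euclideanSpace_fin])

/-- The manifold structure of `𝓜(𝔹)`. -/
noncomputable def moebiusStructure : SmoothStructure 7 MoebiusB :=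
  letI : TopologicalSpace MoebiusB := .induced moebiusEquiv.symm inferInstance
  letI Φ : MoebiusB ≃ₜ BaseParam := moebiusEquiv.symm.toHomeomorphOfIsInducing ⟨rfl⟩
  { top := inferInstance
    charts := transportedChartedSpace baseModelWithCorners baseModelEquiv Φ
    isSmoothManifold := isSmoothManifold_transported baseModelEquiv Φ }

/-- The quotient gets the structure transported from the same `ℍ × Sp(1)`, so the required
diffeomorphism is the passage through that product. -/
theorem isQuotientStructure_moebiusStructure : IsQuotientStructure moebiusStructure := by
  let := moebiusStructure.top
  let := moebiusStructure.charts
  let Φ : MoebiusB ≃ₜ BaseParam := moebiusEquiv.symm.toHomeomorphOfIsInducing ⟨rfl⟩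
  let D : MoebiusB ≃ₘ^∞⟮𝓡 7, baseModelWithCorners⟯ BaseParam :=
    transportedDiffeomorph baseModelEquiv Φ
  let C := transportedChartedSpace baseModelWithCorners baseModelEquiv quotientHomeomorph
  let D' : (Sp11 ⧸ scalarSubgroup) ≃ₘ^∞⟮𝓡 7, baseModelWithCorners⟯ BaseParam :=
    transportedDiffeomorph baseModelEquiv quotientHomeomorph
  have hmk : ∀ A : Sp11, D'.symm (baseProj A) = (A : Sp11 ⧸ scalarSubgroup) :=
    quotientHomeomorph_symm_baseProj
  have hsm : ContMDiff sp11ModelWithCorners (𝓡 7) ∞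
      (fun A : Sp11 => (A : Sp11 ⧸ scalarSubgroup)) := by
    simp only [← hmk]
    exact D'.symm.contMDiff.comp contMDiff_baseProj
  refine ⟨C, isSmoothManifold_transported baseModelEquiv quotientHomeomorph,
    ⟨QuotientGroup.mk_surjective, hsm, fun A => ?_⟩, D'.trans D.symm, fun A => ?_⟩
  · obtain ⟨g, hg⟩ := exists_rightTranslation_section A
    -- The global section is translated by the fixed `g` so that it passes through `A`; a smooth
    -- section through `A` makes the differential there surjective.
    have hs : ContMDiff (𝓡 7) sp11ModelWithCorners ∞
        fun x : Sp11 ⧸ scalarSubgroup => trivialization (D' x, g) :=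
      trivialization.contMDiff.comp (D'.contMDiff.prodMk contMDiff_const)
    refine surjective_mfderiv_of_section (hsm.mdifferentiable (by simp) A)
      (hs.mdifferentiable (by simp) _) hg fun x => ?_
    rw [← hmk, trivialization_apply, baseProj_rightTranslation_section, D'.symm_apply_apply]
  · exact moebiusEquiv_baseProj A

/-! ### Uniqueness of the structure and the principal bundle -/

/-- A manifold structure on the quotient for which the quotient map is a submersion is diffeomorphic
to `ℍ × Sp(1)`. -/
theorem contMDiff_quotientHomeomorph
    [ChartedSpace (EuclideanSpace ℝ (Fin 7)) (Sp11 ⧸ scalarSubgroup)]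
    (hM : IsSmoothManifold (𝓡 7) (Sp11 ⧸ scalarSubgroup))
    (hf : IsSurjSubmersion sp11ModelWithCorners (𝓡 7)
      (fun A : Sp11 => (A : Sp11 ⧸ scalarSubgroup))) :
    ContMDiff (𝓡 7) baseModelWithCorners ∞ quotientHomeomorph ∧
      ContMDiff baseModelWithCorners (𝓡 7) ∞ quotientHomeomorph.symm := by
  have := hM.isManifold
  -- This map is the quotient map restricted to the global section, hence smooth for any admissible
  -- structure.
  have h : ContMDiff baseModelWithCorners (𝓡 7) ∞ quotientHomeomorph.symm := by
    have h' := hf.smooth.comp contMDiff_baseSection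
    convert h' using 1
    funext z
    simp only [Function.comp_apply]
    rw [← quotientHomeomorph_symm_baseProj, baseProj_section]
  have hsurj : ∀ z, Function.Surjective
      (mfderiv baseModelWithCorners (𝓡 7) quotientHomeomorph.symm z) := fun z => by
    -- Composed with `baseProj` the map is the quotient map itself, a submersion by hypothesis.
    refine surjective_mfderiv_of_comp (baseProj_section z) (h.mdifferentiable (by simp) _)
      (contMDiff_baseProj.mdifferentiable (by simp) _) ?_
    rw [show quotientHomeomorph.symm ∘ baseProj = fun A : Sp11 => (A : Sp11 ⧸ scalarSubgroup) from
      funext quotientHomeomorph_symm_baseProj]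
    exact hf.surjective_mfderiv (baseSection z)
  have hdim : Module.finrank ℝ (ℍ[ℝ] × EuclideanSpace ℝ (Fin 3)) =
      Module.finrank ℝ (EuclideanSpace ℝ (Fin 7)) := by
    rw [finrank_baseModel, finrank_euclideanSpace_fin]
  exact ⟨contMDiff_symm_of_surjective_mfderiv hdim quotientHomeomorph.symm h hsurj, h⟩

/-- The coordinates take values in a model that does not depend on `S`, and the formula fixes them
pointwise; uniqueness and the bundle both rest on this. -/
theorem IsQuotientStructure.exists_diffeomorph {S : SmoothStructure 7 MoebiusB}
    (hS : IsQuotientStructure S) :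
    letI := S.top
    letI := S.charts
    ∃ D : BaseParam ≃ₘ^∞⟮baseModelWithCorners, 𝓡 7⟯ MoebiusB,
      ∀ A, D (baseProj A) = moebiusProj A := by
  let := S.top
  let := S.charts
  obtain ⟨C, hM, hf, e, he⟩ := hS
  obtain ⟨h1, h2⟩ := contMDiff_quotientHomeomorph hM hf
  refine ⟨(⟨quotientHomeomorph.symm.toEquiv, h2, h1⟩ :
    BaseParam ≃ₘ^∞⟮baseModelWithCorners, 𝓡 7⟯ (Sp11 ⧸ scalarSubgroup)).trans e, fun A => ?_⟩
  exact (congrArg e (quotientHomeomorph_symm_baseProj A)).trans (he A)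

/-- The coordinates for `S` and for `T` are the same map of sets from `ℍ × Sp(1)`, so the identity
is one diffeomorphism after the inverse of the other. -/
theorem IsQuotientStructure.same {S T : SmoothStructure 7 MoebiusB} (hS : IsQuotientStructure S)
    (hT : IsQuotientStructure T) : S.Same T := by
  have key : ∀ {S T : SmoothStructure 7 MoebiusB}, IsQuotientStructure S → IsQuotientStructure T →
      @ContMDiff ℝ _ _ _ _ _ _ (𝓡 7) MoebiusB S.top S.charts _ _ _ _ _ (𝓡 7) MoebiusB T.top
        T.charts ∞ id := by
    intro S T hS hT
    obtain ⟨D, hD⟩ := hS.exists_diffeomorph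
    obtain ⟨D', hD'⟩ := hT.exists_diffeomorph
    refine @contMDiff_of_diffeomorph _ _ _ _ _ _ _ S.top S.charts _ _ _ _ _ _ _ T.top T.charts
      _ _ _ _ _ _ _ _ _ D D' id fun z => ?_
    rw [← baseProj_section z]
    exact (hD _).trans (hD' _).symm
  exact ⟨key hS hT, key hT hS⟩

theorem IsQuotientStructure.isMoebiusBundle {S : SmoothStructure 7 MoebiusB}
    (hS : IsQuotientStructure S) : IsMoebiusBundle S := by
  let := S.top
  let := S.charts
  obtain ⟨D, hD⟩ := hS.exists_diffeomorph
  have hsm : ContMDiff sp11ModelWithCorners (𝓡 7) ∞ moebiusProj := by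
    rw [show moebiusProj = D ∘ baseProj from funext fun A => (hD A).symm]
    exact D.contMDiff.comp contMDiff_baseProj
  have hsec : ∀ (x : MoebiusB) (g : Sp1),
      moebiusProj (rightTranslation (baseSection (D.symm x)) g) = x := fun x g => by
    rw [← hD, baseProj_rightTranslation_section, D.apply_symm_apply]
  -- The trivialization over `ℍ × Sp(1)`, with the base replaced by `𝓜(𝔹)` through `D`.
  let φ : (MoebiusB × Sp1) ≃ₘ^∞⟮(𝓡 7).prod (𝓡 3), sp11ModelWithCorners⟯ Sp11 :=
    (D.symm.prodCongr (Diffeomorph.refl (𝓡 3) Sp1 ∞)).trans trivialization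
  exact
  { total := isSmoothManifold_Sp11
    base := S.isSmoothManifold
    group := isSmoothManifold_Sp1
    lieGroup := inferInstance
    submersion := by
      refine ⟨fun x => ⟨_, hsec x 1⟩, hsm, fun A => ?_⟩
      obtain ⟨g, hg⟩ := exists_rightTranslation_section A
      have hs : ContMDiff (𝓡 7) sp11ModelWithCorners ∞
          fun x : MoebiusB => trivialization (D.symm x, g) :=
        trivialization.contMDiff.comp (D.symm.contMDiff.prodMk contMDiff_const)
      refine surjective_mfderiv_of_section (hsm.mdifferentiable (by simp) A)
        (hs.mdifferentiable (by simp) _) ?_ fun x => hsec x g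
      rw [← hD, D.symm_apply_apply]
      exact hg
    act_one := rightTranslation_one
    act_mul := rightTranslation_mul
    smooth_act := contMDiff_rightTranslation
    free := fun A u h => by
      have h' := A.mul_scalarHom_apply u 0 0
      rw [h] at h'
      exact Subtype.ext (mul_left_cancel₀ A.a_ne_zero (h'.symm.trans (mul_one _).symm))
    -- The set in question is the projection to `Sp(1)` of the pairs in `K × Sp(1)` whose translate
    -- lies in `K`, a closed subset of a compact set.
    proper := fun K hK => by
      have := isSmoothManifold_Sp11.t2
      have hcl : IsClosed {x : Sp11 × Sp1 | rightTranslation x.1 x.2 ∈ K} :=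
        hK.isClosed.preimage contMDiff_rightTranslation.continuous
      have hc := ((hK.prod (isCompact_univ (X := Sp1))).inter_right hcl).image continuous_snd
      convert hc using 1
      ext g
      constructor
      · rintro ⟨_, ⟨A, hA, rfl⟩, hA'⟩
        exact ⟨(A, g), ⟨⟨hA, trivial⟩, hA'⟩, rfl⟩
      · rintro ⟨⟨A, g⟩, ⟨⟨hA, -⟩, hA'⟩, rfl⟩
        exact ⟨_, ⟨A, hA, rfl⟩, hA'⟩
    orbit_eq_fiber := fun A => by
      ext B
      exact moebiusProj_eq_iff.symm.trans eq_comm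
    locallyTrivial := fun x => ⟨Set.univ, isOpen_univ, trivial, φ.toPartialDiffeomorph,
      Set.univ_prod_univ.symm, rfl, fun y _ g =>
        ⟨hsec y g, fun h => rightTranslation_mul _ g h⟩⟩ }

end QuatMoebius

theorem mainTheorem6 :
    (∀ (A : QuatMoebius.Sp11) (q : QuatMoebius.UnitBall),
      QuatMoebius.regularMoebius A q ∈ Metric.ball (0 : ℍ[ℝ]) 1) ∧
    (∃ S : QuatMoebius.SmoothStructure 7 QuatMoebius.MoebiusB,
      QuatMoebius.IsQuotientStructure S) ∧
    (∀ S T : QuatMoebius.SmoothStructure 7 QuatMoebius.MoebiusB,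
      QuatMoebius.IsQuotientStructure S → QuatMoebius.IsQuotientStructure T → S.Same T) ∧
    (∀ S : QuatMoebius.SmoothStructure 7 QuatMoebius.MoebiusB,
      QuatMoebius.IsQuotientStructure S → QuatMoebius.IsMoebiusBundle S) := by
  exact ⟨QuatMoebius.regularMoebius_mem_ball,
    ⟨QuatMoebius.moebiusStructure, QuatMoebius.isQuotientStructure_moebiusStructure⟩,
    fun _ _ hS hT => hS.same hT, fun _ hS => hS.isMoebiusBundle⟩
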